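/- **Notation and definitions.** Let $\theta\ge 1/2$. *Gelfand–Shilov space.* $\mathcal S_\theta(\mathbb R^d)$ is the space of all $f\in C^\infty(\mathbb R^d)$ such that for some $C>0$ $$p_C(f):=\sup_{\alpha,\beta\in\mathbb N^d}\sup_{x\in\mathbb R^d}C^{-|\alpha|-|\beta|}(\alpha!)^{-\theta}(\beta!)^{-\theta}|x^\alpha\partial^\beta f(x)|<\infty ,$$ and $\mathcal S_\theta'(\mathbb R^d)$ is the space of linear forms $u$ on $\mathcal S_\theta(\mathbb R^d)$ such that for every $\varepsilon>0$ there is $K_\varepsilon>0$ with $|\langle u,f\rangle|\le K_\varepsilon\, p_\varepsilon(f)$ for all $f\in\mathcal S_\theta(\mathbb R^d)$. The pairing $\langle u,f\rangle$ is bilinear. *Wave front set.* For $u\in\mathcal S_\theta'(\mathbb R^d)$ and $z\in\mathbb C^d$ let $Tu(z)=2^{-d/2}\pi^{-3d/4}\langle u_y,e^{i\langle z,y\rangle-\frac12|y|^2}\rangle$, where $\langle z,y\rangle=\sum_j z_jy_j$, be the FBI transform with the standard phase $\langle z,y\rangle+\frac i2|y|^2$. The global wave front set $\mathrm{WF}^\theta_{\mathrm{gl}}(u)\subset\mathbb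 R^{2d}\setminus\{0\}$ is the set of all $(x_0,\xi_0)\ne 0$ for which there do **not** exist an open conic neighbourhood $\Gamma\subset\mathbb C^d$ of $-\xi_0-ix_0$ and constants $\varepsilon,C>0$ such that $$|Tu(z)|\le C\,e^{-\varepsilon|z|^{1/\theta}+\frac12|\operatorname{Im}z|^2},\qquad z\in\Gamma .$$ *Localization operators.* Let $\psi(y)=\pi^{-d/4}e^{-|y|^2/2}$ and let $V_\psi u(x,\xi)=(2\pi)^{-d/2}\langle u,\psi(\cdot-x)e^{-i\langle\xi,\cdot\rangle}\rangle$ be the short-time Fourier transform of $u\in\mathcal S_\theta'(\mathbb R^d)$ (for $u=g\in\mathcal S_\theta(\mathbb R^d)$ the pairing is $\int g(y)\,\psi(y-x)e^{-i\langle\xi,y\rangle}\,dy$). The localization operator $A^\psi_a=V_\psi^*\,a\,V_\psi$ with symbol $a$ is defined weakly by $$\langle A^\psi_a u,f\rangle=\int_{\mathbb R^{2d}}a(x,\xi)\,V_\psi u(x,\xi)\,\overline{V_\psi\bar f(x,\xi)}\;dx\,d\xi,\qquad u\in\mathcal S_\theta'(\mathbb R^d),\ f\in\mathcal S_\theta(\mathbb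 R^d).$$ **Proposition (Microlocality of localization operators).** Let $\theta>1/2$ and let $a\in L^\infty_{\mathrm{loc}}(\mathbb R^{2d})$ be such that for every $\varepsilon>0$ there is $C_\varepsilon>0$ with $$|a(x,\xi)|\le C_\varepsilon\, e^{\varepsilon(|x|^{1/\theta}+|\xi|^{1/\theta})}\qquad\text{for almost all }(x,\xi)\in\mathbb R^{2d}.$$ Then the integral defining $\langle A^\psi_au,f\rangle$ converges absolutely for all $u\in\mathcal S_\theta'(\mathbb R^d)$ and $f\in\mathcal S_\theta(\mathbb R^d)$ and defines a linear operator $A^\psi_a:\mathcal S_\theta'(\mathbb R^d)\to\mathcal S_\theta'(\mathbb R^d)$, and $$\mathrm{WF}^\theta_{\mathrm{gl}}(A^\psi_au)\subset\mathrm{WF}^\theta_{\mathrm{gl}}(u)\qquad\text{for every }u\in\mathcal S_\theta'(\mathbb R^d).$$ -/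

import Mathlib

open scoped ContDiff Nat ComplexConjugate
open MeasureTheory

namespace GelfandShilov

/-- `ℝ^d` with the Euclidean norm. -/
abbrev Rd (d : ℕ) : Type := EuclideanSpace ℝ (Fin d)

/-- `ℂ^d` with the Hermitian norm. -/
abbrev Cd (d : ℕ) : Type := EuclideanSpace ℂ (Fin d)

/-! ### Gelfand-Shilov functions and tempered ultradistributions -/

/-- The partial derivative `∂_i f`. -/
noncomputable def partialDeriv {d : ℕ} (i : Fin d) (f : Rd d → ℂ) : Rd d → ℂ :=
  fun x => fderiv ℝ f x (EuclideanSpace.single i 1)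

/-- The derivative `∂^β f` for a multi-index `β`. -/
noncomputable def multiDeriv {d : ℕ} (β : Fin d → ℕ) (f : Rd d → ℂ) : Rd d → ℂ :=
  (List.finRange d).foldr (fun i g => (partialDeriv i)^[β i] g) f

/-- `sup_{α,β,x} C^{-|α|-|β|} (α!)^{-θ} (β!)^{-θ} |x^α ∂^β f(x)| ≤ M`. -/
def GSBound {d : ℕ} (θ C M : ℝ) (f : Rd d → ℂ) : Prop :=
  ∀ (α β : Fin d → ℕ) (x : Rd d),
    ‖((∏ i, x i ^ α i : ℝ) : ℂ) * multiDeriv β f x‖ ≤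
      M * C ^ (∑ i, α i + ∑ i, β i) *
        ((∏ i, (α i)! : ℕ) : ℝ) ^ θ * ((∏ i, (β i)! : ℕ) : ℝ) ^ θ

theorem contDiff_partialDeriv {d : ℕ} (i : Fin d) {f : Rd d → ℂ} (hf : ContDiff ℝ ∞ f) :
    ContDiff ℝ ∞ (partialDeriv i f) :=
  (hf.fderiv_right (m := ∞) (by simp)).clm_apply contDiff_const

theorem contDiff_iterate_partialDeriv {d : ℕ} (i : Fin d) (n : ℕ) {f : Rd d → ℂ}
    (hf : ContDiff ℝ ∞ f) : ContDiff ℝ ∞ ((partialDeriv i)^[n] f) := by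
  induction n with
  | zero => exact hf
  | succ n ih =>
    rw [Function.iterate_succ_apply']
    exact contDiff_partialDeriv i ih

theorem partialDeriv_add {d : ℕ} (i : Fin d) {f g : Rd d → ℂ} (hf : ContDiff ℝ ∞ f)
    (hg : ContDiff ℝ ∞ g) : partialDeriv i (f + g) = partialDeriv i f + partialDeriv i g := by
  funext x
  have h1 := (hf.differentiable (by simp)) x
  have h2 := (hg.differentiable (by simp)) x
  simp [partialDeriv, fderiv_add h1 h2]

theorem partialDeriv_smul {d : ℕ} (i : Fin d) (c : ℂ) {f : Rd d → ℂ} (hf : ContDiff ℝ ∞ f) :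
    partialDeriv i (c • f) = c • partialDeriv i f := by
  funext x
  have h1 := (hf.differentiable (by simp)) x
  simp [partialDeriv, fderiv_const_smul h1 c]

theorem multiDeriv_linear {d : ℕ} (β : Fin d → ℕ) {f g : Rd d → ℂ} (hf : ContDiff ℝ ∞ f)
    (hg : ContDiff ℝ ∞ g) (c : ℂ) :
    multiDeriv β (f + g) = multiDeriv β f + multiDeriv β g ∧
      multiDeriv β (c • f) = c • multiDeriv β f := by
  have hit : ∀ (i : Fin d) (n : ℕ) (f g : Rd d → ℂ), ContDiff ℝ ∞ f → ContDiff ℝ ∞ g →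
      (partialDeriv i)^[n] (f + g) = (partialDeriv i)^[n] f + (partialDeriv i)^[n] g ∧
      (partialDeriv i)^[n] (c • f) = c • (partialDeriv i)^[n] f := by
    intro i n f g hf hg
    induction n with
    | zero => simp
    | succ n ih =>
      simp only [Function.iterate_succ_apply']
      rw [ih.1, ih.2, partialDeriv_add i (contDiff_iterate_partialDeriv i n hf)
        (contDiff_iterate_partialDeriv i n hg),
        partialDeriv_smul i c (contDiff_iterate_partialDeriv i n hf)]
      exact ⟨rfl, rfl⟩
  have main : ∀ l : List (Fin d),
      ContDiff ℝ ∞ (l.foldr (fun i g => (partialDeriv i)^[β i] g) f) ∧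
      ContDiff ℝ ∞ (l.foldr (fun i g => (partialDeriv i)^[β i] g) g) ∧
      l.foldr (fun i g => (partialDeriv i)^[β i] g) (f + g) =
        l.foldr (fun i g => (partialDeriv i)^[β i] g) f +
        l.foldr (fun i g => (partialDeriv i)^[β i] g) g ∧
      l.foldr (fun i g => (partialDeriv i)^[β i] g) (c • f) =
        c • l.foldr (fun i g => (partialDeriv i)^[β i] g) f := by
    intro l
    induction l with
    | nil => exact ⟨hf, hg, rfl, rfl⟩
    | cons i l ih =>
      obtain ⟨h1, h2, h3, h4⟩ := ih
      simp only [List.foldr_cons]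
      rw [h3, h4]
      exact ⟨contDiff_iterate_partialDeriv i _ h1, contDiff_iterate_partialDeriv i _ h2,
        (hit i _ _ _ h1 h2).1, (hit i _ _ _ h1 h2).2⟩
  exact (main _).2.2

theorem GSBound.nonneg {d : ℕ} {θ C M : ℝ} {f : Rd d → ℂ} (h : GSBound θ C M f) : 0 ≤ M := by
  have := (norm_nonneg _).trans (h 0 0 0)
  simpa using this

theorem GSBound.mono {d : ℕ} {θ C C' M : ℝ} {f : Rd d → ℂ} (h : GSBound θ C M f)
    (hC : 0 < C) (hCC : C ≤ C') : GSBound θ C' M f := by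
  intro α β x
  have hM := h.nonneg
  refine (h α β x).trans ?_
  gcongr

/-- The Gelfand-Shilov space `S_θ(ℝ^d)`. -/
noncomputable def GS (θ : ℝ) (d : ℕ) : Submodule ℂ (Rd d → ℂ) where
  carrier := {f | ContDiff ℝ ∞ f ∧ ∃ C > 0, ∃ M, GSBound θ C M f}
  zero_mem' := by
    refine ⟨contDiff_const, 1, one_pos, 0, fun α β x => ?_⟩
    have h0 := (multiDeriv_linear β (f := 0) (g := 0) contDiff_const contDiff_const 0).2
    rw [zero_smul, zero_smul] at h0
    simp [h0]
  add_mem' := by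
    rintro f g ⟨hf, C, hC, M, hM⟩ ⟨hg, C', hC', M', hM'⟩
    refine ⟨hf.add hg, max C C', lt_max_of_lt_left hC, M + M', fun α β x => ?_⟩
    rw [(multiDeriv_linear β hf hg 0).1, Pi.add_apply, mul_add, add_mul, add_mul, add_mul]
    exact (norm_add_le _ _).trans (add_le_add
      (hM.mono hC (le_max_left _ _) α β x) (hM'.mono hC' (le_max_right _ _) α β x))
  smul_mem' := by
    rintro c f ⟨hf, C, hC, M, hM⟩
    refine ⟨contDiff_const.smul hf, C, hC, ‖c‖ * M, fun α β x => ?_⟩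
    rw [(multiDeriv_linear β hf hf c).2, Pi.smul_apply, smul_eq_mul, mul_left_comm, norm_mul,
      mul_assoc, mul_assoc, mul_assoc, ← mul_assoc M, ← mul_assoc (M * _)]
    exact mul_le_mul_of_nonneg_left (hM α β x) (norm_nonneg _)

/-- The space `S_θ'(ℝ^d)` of tempered ultradistributions: the linear forms `u` on `S_θ(ℝ^d)` such
that for every `ε > 0` there is `K` with
`|u(f)| ≤ K sup_{α,β,x} ε^{-|α|-|β|} (α!)^{-θ} (β!)^{-θ} |x^α ∂^β f(x)|` for all `f`
(no condition on those `f` for which the supremum is infinite). -/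
noncomputable def GSDual (θ : ℝ) (d : ℕ) : Submodule ℂ (GS θ d →ₗ[ℂ] ℂ) where
  carrier := {u | ∀ ε > 0, ∃ K : ℝ, ∀ (f : GS θ d) (M : ℝ),
    GSBound θ ε M (f : Rd d → ℂ) → ‖u f‖ ≤ K * M}
  zero_mem' := fun ε _ => ⟨0, fun f M _ => by simp⟩
  add_mem' := by
    intro u v hu hv ε hε
    obtain ⟨K, hK⟩ := hu ε hε
    obtain ⟨L, hL⟩ := hv ε hε
    refine ⟨K + L, fun f M hf => ?_⟩
    rw [LinearMap.add_apply, add_mul]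
    exact (norm_add_le _ _).trans (add_le_add (hK f M hf) (hL f M hf))
  smul_mem' := by
    intro c u hu ε hε
    obtain ⟨K, hK⟩ := hu ε hε
    refine ⟨‖c‖ * K, fun f M hf => ?_⟩
    rw [LinearMap.smul_apply, smul_eq_mul, norm_mul, mul_assoc]
    exact mul_le_mul_of_nonneg_left (hK f M hf) (norm_nonneg _)

/-! ### The Gaussian kernel of the FBI transform belongs to `S_θ` for `θ ≥ 1/2` -/

/-- `y ↦ e^{iφ(z,y)}` for the standard phase `φ(z,y) = ⟨z,y⟩ + (i/2)|y|²`, where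
`⟨z,y⟩ = ∑ z_j y_j`. -/
noncomputable def fbiKernel {d : ℕ} (z : Cd d) (y : Rd d) : ℂ :=
  Complex.exp (Complex.I * (∑ j, z j * (y j : ℂ) + Complex.I / 2 * ((‖y‖ ^ 2 : ℝ) : ℂ)))

/-- The one-dimensional kernel, as an entire function. -/
noncomputable def kernelOne (z w : ℂ) : ℂ := Complex.exp (Complex.I * z * w - w ^ 2 / 2)

theorem contDiff_kernelOne (z : ℂ) : ContDiff ℂ ω (kernelOne z) := by
  unfold kernelOne
  fun_prop

theorem differentiable_iteratedDeriv_kernelOne (z : ℂ) (n : ℕ) :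
    Differentiable ℂ (iteratedDeriv n (kernelOne z)) :=
  ((contDiff_kernelOne z).of_le (le_top : (∞ : WithTop ℕ∞) ≤ ω)).differentiable_iteratedDeriv n
    (by exact_mod_cast WithTop.coe_lt_top n)

theorem fbiKernel_eq_prod {d : ℕ} (z : Cd d) (y : Rd d) :
    fbiKernel z y = ∏ j, kernelOne (z j) (y j : ℂ) := by
  unfold fbiKernel kernelOne
  rw [← Complex.exp_sum, EuclideanSpace.real_norm_sq_eq]
  congr 1
  push_cast
  rw [mul_add, Finset.mul_sum, ← mul_assoc, Finset.mul_sum, ← Finset.sum_add_distrib]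
  refine Finset.sum_congr rfl fun j _ => ?_
  have : Complex.I * (Complex.I / 2) = -1 / 2 := by
    rw [← mul_div_assoc, Complex.I_mul_I]
  rw [this]
  ring

theorem contDiff_kernel_prod {d : ℕ} (z : Cd d) (n : Fin d → ℕ) :
    ContDiff ℝ ∞ (fun y : Rd d => ∏ j, iteratedDeriv (n j) (kernelOne (z j)) (y j : ℂ)) := by
  refine contDiff_prod fun j _ => ?_
  have h1 : ContDiff ℝ ∞ (iteratedDeriv (n j) (kernelOne (z j))) :=
    ((differentiable_iteratedDeriv_kernelOne (z j) (n j)).contDiff (n := ∞)).restrict_scalars ℝ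
  have h2 : ContDiff ℝ ∞ (fun y : Rd d => ((y j : ℝ) : ℂ)) :=
    Complex.ofRealCLM.contDiff.comp (EuclideanSpace.proj (𝕜 := ℝ) j).contDiff
  exact h1.comp h2

theorem partialDeriv_prod {d : ℕ} (z : Cd d) (n : Fin d → ℕ) (i : Fin d) :
    partialDeriv i (fun y : Rd d => ∏ j, iteratedDeriv (n j) (kernelOne (z j)) (y j : ℂ)) =
      fun y : Rd d => ∏ j, iteratedDeriv (Function.update n i (n i + 1) j)
        (kernelOne (z j)) (y j : ℂ) := by
  funext y
  have hF := ((contDiff_kernel_prod z n).differentiable (by simp)) y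
  have h1 := hF.hasFDerivAt.hasLineDerivAt (EuclideanSpace.single i 1)
  have hG : HasDerivAt (iteratedDeriv (n i) (kernelOne (z i)))
      (iteratedDeriv (n i + 1) (kernelOne (z i)) (y i : ℂ)) ((y i + (0 : ℝ) : ℝ) : ℂ) := by
    rw [iteratedDeriv_succ, add_zero]
    exact (differentiable_iteratedDeriv_kernelOne (z i) (n i) _).hasDerivAt
  have hG2 : HasDerivAt (fun t : ℝ => iteratedDeriv (n i) (kernelOne (z i)) ((y i + t : ℝ) : ℂ))
      (iteratedDeriv (n i + 1) (kernelOne (z i)) (y i : ℂ)) 0 := by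
    have := (hG.comp_ofReal (z := y i + 0)).comp_const_add (y i) 0
    exact this
  have h2 : HasLineDerivAt ℝ
      (fun y : Rd d => ∏ j, iteratedDeriv (n j) (kernelOne (z j)) (y j : ℂ))
      (iteratedDeriv (n i + 1) (kernelOne (z i)) (y i : ℂ) *
        ∏ j ∈ Finset.univ.erase i, iteratedDeriv (n j) (kernelOne (z j)) (y j : ℂ)) y
      (EuclideanSpace.single i 1) := by
    refine (hG2.mul_const _).congr_of_eventuallyEq (Filter.Eventually.of_forall fun t => ?_)
    simp only []
    rw [← Finset.mul_prod_erase _ _ (Finset.mem_univ i)]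
    congr 1
    · simp
    · refine Finset.prod_congr rfl fun j hj => ?_
      simp [Finset.ne_of_mem_erase hj]
  have h3 := h1.unique h2
  unfold partialDeriv
  rw [h3, ← Finset.mul_prod_erase _ _ (Finset.mem_univ i)]
  congr 1
  · simp
  · refine Finset.prod_congr rfl fun j hj => ?_
    simp [Finset.ne_of_mem_erase hj]

theorem multiDeriv_fbiKernel {d : ℕ} (z : Cd d) (β : Fin d → ℕ) (y : Rd d) :
    multiDeriv β (fbiKernel z) y = ∏ j, iteratedDeriv (β j) (kernelOne (z j)) (y j : ℂ) := by
  have hit : ∀ (i : Fin d) (m : ℕ) (n : Fin d → ℕ),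
      (partialDeriv i)^[m]
        (fun y : Rd d => ∏ j, iteratedDeriv (n j) (kernelOne (z j)) (y j : ℂ)) =
      fun y : Rd d => ∏ j, iteratedDeriv (Function.update n i (n i + m) j)
        (kernelOne (z j)) (y j : ℂ) := by
    intro i m n
    induction m with
    | zero => simp
    | succ m ih =>
      rw [Function.iterate_succ_apply', ih, partialDeriv_prod]
      simp [add_assoc]
  have main : ∀ l : List (Fin d), l.Nodup →
      l.foldr (fun i g => (partialDeriv i)^[β i] g) (fbiKernel z) =
      fun y : Rd d => ∏ j, iteratedDeriv (if j ∈ l then β j else 0)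
        (kernelOne (z j)) (y j : ℂ) := by
    intro l hl
    induction l with
    | nil =>
      funext y
      simp [fbiKernel_eq_prod]
    | cons i l ih =>
      rw [List.nodup_cons] at hl
      rw [List.foldr_cons, ih hl.2, hit i (β i) (fun j => if j ∈ l then β j else 0)]
      funext y
      refine Finset.prod_congr rfl fun j _ => ?_
      by_cases hj : j = i
      · subst hj
        simp [hl.1]
      · simp [hj]
  have := congrFun (main _ (List.nodup_finRange d)) y
  simpa [multiDeriv] using this

theorem norm_kernelOne_le (z : ℂ) (t r : ℝ) (w : ℂ) (hw : ‖w - t‖ = r) :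
    ‖kernelOne z w‖ ≤ Real.exp (3 * ‖z‖ ^ 2 + 2 * r ^ 2 - t ^ 2 / 8) := by
  unfold kernelOne
  rw [Complex.norm_exp]
  refine Real.exp_le_exp.mpr ?_
  obtain ⟨h, rfl⟩ : ∃ h : ℂ, w = t + h := ⟨w - t, by ring⟩
  have hr : ‖h‖ = r := by simpa using hw
  have h1 : (Complex.I * z * (t + h)).re ≤ ‖z‖ * (|t| + r) := by
    refine (Complex.re_le_norm _).trans ?_
    rw [norm_mul, norm_mul, Complex.norm_I, one_mul]
    gcongr
    refine (norm_add_le _ _).trans ?_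
    simp [hr]
  have h2 : (((t : ℂ) + h) ^ 2 / 2).re = (t ^ 2 + 2 * t * h.re + (h.re ^ 2 - h.im ^ 2)) / 2 := by
    have : ((t : ℂ) + h) ^ 2 / 2 = (((1 / 2 : ℝ) : ℂ)) * (((t : ℂ) + h) * ((t : ℂ) + h)) := by
      push_cast
      ring
    rw [this, Complex.re_ofReal_mul]
    simp
    ring
  have h3 : h.re ^ 2 + h.im ^ 2 = r ^ 2 := by
    rw [← hr, Complex.sq_norm, Complex.normSq_apply]
    ring
  have h4 := sq_abs t
  rw [Complex.sub_re, h2]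
  nlinarith [sq_nonneg (t / 2 + h.re), sq_nonneg (‖z‖ - r), sq_nonneg (2 * ‖z‖ - |t| / 2),
    sq_nonneg h.re, sq_nonneg h.im, sq_nonneg (t + 2 * h.re), sq_nonneg ‖z‖]

theorem kernelOne_bound (z : ℂ) (a b : ℕ) (t : ℝ) :
    |t| ^ a * ‖iteratedDeriv b (kernelOne z) (t : ℂ)‖ ≤
      Real.exp (3 * ‖z‖ ^ 2 + 2) * Real.exp 2 ^ (a + b) * √(a ! : ℝ) * √(b ! : ℝ) := by
  set r : ℝ := √((b : ℝ) + 1) with hr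
  have hr0 : 0 < r := Real.sqrt_pos.mpr (by positivity)
  have hr2 : r ^ 2 = (b : ℝ) + 1 := Real.sq_sqrt (by positivity)
  have h1 := Complex.norm_iteratedDeriv_le_of_forall_mem_sphere_norm_le b hr0
    (f := kernelOne z) (c := (t : ℂ))
    (((contDiff_kernelOne z).differentiable (by simp)).diffContOnCl)
    (C := Real.exp (3 * ‖z‖ ^ 2 + 2 * r ^ 2 - t ^ 2 / 8))
    (fun w hw => norm_kernelOne_le z t r w (by simpa [dist_eq_norm] using hw))
  have h2 : (b ! : ℝ) / r ^ b ≤ √(b ! : ℝ) := by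
    rw [div_le_iff₀ (by positivity)]
    have h3 : √(b ! : ℝ) ≤ r ^ b := by
      refine Real.sqrt_le_iff.mpr ⟨by positivity, ?_⟩
      rw [← pow_mul, mul_comm b 2, pow_mul, hr2]
      calc (b ! : ℝ) ≤ (b : ℝ) ^ b := by exact_mod_cast Nat.factorial_le_pow b
        _ ≤ _ := by gcongr; linarith
    calc (b ! : ℝ) = √(b ! : ℝ) * √(b ! : ℝ) := (Real.mul_self_sqrt (by positivity)).symm
      _ ≤ _ := by gcongr
  have h4 : |t| ^ a * Real.exp (-(t ^ 2 / 8)) ≤ 2 ^ a * √(a ! : ℝ) := by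
    have h5 := Real.pow_div_factorial_le_exp (x := t ^ 2 / 4) (by positivity) a
    rw [div_le_iff₀ (by positivity)] at h5
    rw [Real.exp_neg, ← div_eq_mul_inv, div_le_iff₀ (Real.exp_pos _)]
    refine abs_le_of_sq_le_sq' ?_ (by positivity) |>.2
    have h6 : Real.exp (t ^ 2 / 8) ^ 2 = Real.exp (t ^ 2 / 4) := by
      rw [← Real.exp_nat_mul]
      congr 1
      push_cast
      ring
    have h7 : (|t| ^ a) ^ 2 = 4 ^ a * (t ^ 2 / 4) ^ a := by
      rw [← mul_pow, ← pow_mul, mul_comm a 2, pow_mul, sq_abs]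
      congr 1
      ring
    rw [mul_pow, mul_pow, h6, Real.sq_sqrt (by positivity), h7, ← pow_mul, mul_comm a 2, pow_mul]
    norm_num
    rw [mul_assoc]
    gcongr
    linarith
  have he2 : (2 : ℝ) ≤ Real.exp 2 := by linarith [Real.add_one_le_exp (2 : ℝ)]
  have h8 : Real.exp (3 * ‖z‖ ^ 2 + 2 * r ^ 2 - t ^ 2 / 8) =
      Real.exp (3 * ‖z‖ ^ 2 + 2) * Real.exp 2 ^ b * Real.exp (-(t ^ 2 / 8)) := by
    rw [← Real.exp_nat_mul, ← Real.exp_add, ← Real.exp_add, hr2]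
    congr 1
    ring
  calc |t| ^ a * ‖iteratedDeriv b (kernelOne z) (t : ℂ)‖
      ≤ |t| ^ a * ((b ! : ℝ) * Real.exp (3 * ‖z‖ ^ 2 + 2 * r ^ 2 - t ^ 2 / 8) / r ^ b) := by
        gcongr
    _ = Real.exp (3 * ‖z‖ ^ 2 + 2) * Real.exp 2 ^ b * (|t| ^ a * Real.exp (-(t ^ 2 / 8))) *
          ((b ! : ℝ) / r ^ b) := by
        rw [h8]
        ring
    _ ≤ Real.exp (3 * ‖z‖ ^ 2 + 2) * Real.exp 2 ^ b * (Real.exp 2 ^ a * √(a ! : ℝ)) *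
          √(b ! : ℝ) := by
        have h9 : |t| ^ a * Real.exp (-(t ^ 2 / 8)) ≤ Real.exp 2 ^ a * √(a ! : ℝ) :=
          h4.trans (by gcongr)
        exact mul_le_mul (mul_le_mul_of_nonneg_left h9 (by positivity)) h2 (by positivity)
          (by positivity)
    _ = _ := by
        rw [pow_add]
        ring

theorem fbiKernel_mem {d : ℕ} {θ : ℝ} (hθ : 1 / 2 ≤ θ) (z : Cd d) : fbiKernel z ∈ GS θ d := by
  refine ⟨?_, Real.exp 2, Real.exp_pos _, ∏ j, Real.exp (3 * ‖z j‖ ^ 2 + 2), fun α β y => ?_⟩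
  · have h := contDiff_kernel_prod z (fun _ => 0)
    have h2 : (fun y : Rd d => ∏ j, iteratedDeriv 0 (kernelOne (z j)) (y j : ℂ)) = fbiKernel z := by
      funext y
      simp [fbiKernel_eq_prod]
    rwa [h2] at h
  · have hs : ∀ m : ℕ, √(m ! : ℝ) ≤ (m ! : ℝ) ^ θ := fun m => by
      rw [Real.sqrt_eq_rpow]
      exact Real.rpow_le_rpow_of_exponent_le (by exact_mod_cast m.factorial_pos) hθ
    rw [multiDeriv_fbiKernel, norm_mul, Complex.norm_real, norm_prod, norm_prod,
      ← Finset.prod_mul_distrib]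
    push_cast
    rw [← Real.finsetProd_rpow _ _ (fun j _ => by positivity),
      ← Real.finsetProd_rpow _ _ (fun j _ => by positivity), ← Finset.sum_add_distrib,
      ← Finset.prod_pow_eq_pow_sum, ← Finset.prod_mul_distrib, ← Finset.prod_mul_distrib,
      ← Finset.prod_mul_distrib]
    refine Finset.prod_le_prod (fun j _ => by positivity) fun j _ => ?_
    rw [norm_pow, Real.norm_eq_abs]
    refine (kernelOne_bound (z j) (α j) (β j) (y j)).trans ?_
    gcongr
    · exact hs _
    · exact hs _

/-! ### FBI transform, global wave front set -/

/-- The FBI transform `T u(z) = 2^{-d/2} π^{-3d/4} ⟨u_y, e^{iφ(z,y)}⟩`, `z ∈ ℂ^d`, with the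
standard phase `φ(z,y) = ⟨z,y⟩ + (i/2)|y|²`. -/
noncomputable def fbi {d : ℕ} {θ : ℝ} (hθ : 1 / 2 ≤ θ) (u : GSDual θ d) (z : Cd d) : ℂ :=
  (((2 : ℝ) ^ (-(d : ℝ) / 2) * Real.pi ^ (-(3 * d : ℝ) / 4) : ℝ) : ℂ) *
    u.1 ⟨fbiKernel z, fbiKernel_mem hθ z⟩

/-- The weight `Φ(z) = |Im z|²/2 = max_y (-Im φ(z,y))`. -/
noncomputable def fbiWeight {d : ℕ} (z : Cd d) : ℝ := (∑ j, (z j).im ^ 2) / 2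

/-- The linear bijection `(x,ξ) ↦ -ξ - ix` of `T^*ℝ^d` onto `ℂ^d`, that is
`(y, -φ'_y(z,y)) ↦ z`. -/
noncomputable def chi {d : ℕ} (p : Rd d × Rd d) : Cd d :=
  WithLp.toLp 2 fun j => -(p.2 j : ℂ) - Complex.I * (p.1 j : ℂ)

/-- A subset of `ℂ^d` is conic if it is invariant under multiplication by positive reals. -/
def IsConic {d : ℕ} (Γ : Set (Cd d)) : Prop := ∀ t : ℝ, 0 < t → ∀ z ∈ Γ, (t : ℂ) • z ∈ Γ

/-- The global wave front set `WF^θ_gl(u) ⊆ T^*ℝ^d ∖ {0}`. -/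
noncomputable def WFgl {d : ℕ} {θ : ℝ} (hθ : 1 / 2 ≤ θ) (u : GSDual θ d) : Set (Rd d × Rd d) :=
  {p | p ≠ 0 ∧ ¬ ∃ Γ : Set (Cd d), IsOpen Γ ∧ IsConic Γ ∧ chi p ∈ Γ ∧
    ∃ ε > 0, ∃ C : ℝ, ∀ z ∈ Γ, ‖fbi hθ u z‖ ≤ C * Real.exp (-ε * ‖z‖ ^ (1 / θ) + fbiWeight z)}

/-! ### Short-time Fourier transform and localization operators -/

/-- The standard Gaussian window `ψ(y) = π^{-d/4} e^{-|y|²/2}`, normalized in `L²`. -/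
noncomputable def gaussWindow {d : ℕ} (y : Rd d) : ℝ :=
  Real.pi ^ (-(d : ℝ) / 4) * Real.exp (-‖y‖ ^ 2 / 2)

/-- The time-frequency shift `y ↦ ψ(y - x) e^{-i⟨ξ,y⟩}`, with `p = (x,ξ)`. -/
noncomputable def gaborAtom {d : ℕ} (p : Rd d × Rd d) (y : Rd d) : ℂ :=
  (gaussWindow (y - p.1) : ℂ) * Complex.exp (-(Complex.I * (inner ℝ p.2 y : ℝ)))

theorem gaborAtom_eq {d : ℕ} (p : Rd d × Rd d) :
    gaborAtom p = (((Real.pi ^ (-(d : ℝ) / 4) * Real.exp (-‖p.1‖ ^ 2 / 2) : ℝ)) : ℂ) •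
      fbiKernel (chi p) := by
  funext y
  have h1 : (∑ j, chi p j * (y j : ℂ)) =
      -((inner ℝ p.2 y : ℝ) : ℂ) - Complex.I * ((inner ℝ p.1 y : ℝ) : ℂ) := by
    simp only [chi, PiLp.inner_apply, RCLike.inner_apply, conj_trivial]
    push_cast
    rw [Finset.mul_sum, ← Finset.sum_neg_distrib, ← Finset.sum_sub_distrib]
    exact Finset.sum_congr rfl fun j _ => by ring
  have h2 : ‖y - p.1‖ ^ 2 = ‖y‖ ^ 2 - 2 * inner ℝ p.1 y + ‖p.1‖ ^ 2 := by
    rw [norm_sub_sq_real, real_inner_comm]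
  simp only [gaborAtom, gaussWindow, fbiKernel, Pi.smul_apply, smul_eq_mul, h1, h2]
  push_cast
  rw [mul_assoc, mul_assoc, ← Complex.exp_add, ← Complex.exp_add]
  congr 2
  linear_combination ((inner ℝ p.1 y : ℂ) - (‖y‖ : ℂ) ^ 2 / 2) * Complex.I_mul_I

theorem gaborAtom_mem {d : ℕ} {θ : ℝ} (hθ : 1 / 2 ≤ θ) (p : Rd d × Rd d) :
    gaborAtom p ∈ GS θ d := by
  rw [gaborAtom_eq]
  exact (GS θ d).smul_mem _ (fbiKernel_mem hθ _)

/-- The short-time Fourier transform `V_ψ u(x,ξ) = (2π)^{-d/2} ⟨u, ψ(· - x) e^{-i⟨ξ,·⟩}⟩` of an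
ultradistribution. -/
noncomputable def stftDual {d : ℕ} {θ : ℝ} (hθ : 1 / 2 ≤ θ) (u : GSDual θ d)
    (p : Rd d × Rd d) : ℂ :=
  (((2 * Real.pi) ^ (-(d : ℝ) / 2) : ℝ) : ℂ) * u.1 ⟨gaborAtom p, gaborAtom_mem hθ p⟩

/-- The short-time Fourier transform
`V_ψ f(x,ξ) = (2π)^{-d/2} ∫ f(y) ψ(y - x) e^{-i⟨ξ,y⟩} dy` of a function. -/
noncomputable def stftFun {d : ℕ} (f : Rd d → ℂ) (p : Rd d × Rd d) : ℂ :=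
  (((2 * Real.pi) ^ (-(d : ℝ) / 2) : ℝ) : ℂ) * ∫ y, f y * gaborAtom p y

/-- `A` is the localization operator `A_a^ψ = V_ψ^* a V_ψ` on `S_θ'(ℝ^d)`, given weakly by
`(A u, g) = ∫ a V_ψ u \overline{V_ψ g} dx dξ` with the pairing `(w, g)` linear in `w` and
antilinear in `g`; here `g = \overline{f}`, so that `(A u, g) = (A u)(f)`. -/
def IsLocalizationOperator {d : ℕ} {θ : ℝ} (hθ : 1 / 2 ≤ θ) (a : Rd d × Rd d → ℂ)
    (A : GSDual θ d →ₗ[ℂ] GSDual θ d) : Prop :=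
  ∀ (u : GSDual θ d) (f : GS θ d),
    Integrable (fun p : Rd d × Rd d =>
      a p * stftDual hθ u p * conj (stftFun (fun y => conj ((f : Rd d → ℂ) y)) p)) ∧
    (A u).1 f = ∫ p : Rd d × Rd d,
      a p * stftDual hθ u p * conj (stftFun (fun y => conj ((f : Rd d → ℂ) y)) p)

end GelfandShilov

open GelfandShilov

namespace GelfandShilov

/-! ### Powers, factorials and sub-Gaussian exponentials -/

/-! The FBI transform and the short-time Fourier transform are the same object in two
normalizations. The Gabor atom at `p` is a constant times `e^{-|x|²/2}` times the FBI kernel at `chi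
p`, so `|V_ψ u(p)| = κ e^{-Φ(chi p)} |Tu(chi p)|` (`exists_norm_stftDual_eq_fbi`). Hence a point
lies outside the wave front set exactly when `V_ψ u` decays like `e^{-ε|·|^{1/θ}}` on a cone around
it.

Testing `A u` on the Gabor atom at `q` gives `V_ψ(Au)(q)`, up to a constant, as the integral of `a
V_ψ u` against the overlap of two Gabor atoms, which is bounded by a multiple of `e^{-|p-q|²/4}`
(`exists_norm_stftFun_gaborAtom_le`). So `V_ψ(Au)` is `a V_ψ u` smeared by a Gaussian. Let `q` range
over a slightly smaller cone. Where `p` is in the original cone, `V_ψ u` decays and `a` cannot spoil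
this, since it grows more slowly than every `e^{δ|p|^{1/θ}}` (`near_exponent_le`). Where `p` is
outside, `|p-q| ≥ c|q|`, and the Gaussian beats the growth of `a V_ψ u` because `1/θ ≤ 2`
(`far_exponent_le`).

Existence of the operator needs two estimates: `V_ψ u` grows more slowly than every `e^{δ|p|^{1/θ}}`
(`exists_norm_stftDual_le`, from seminorms of Gabor atoms), while `V_ψ f` decays at some rate `ε`
(`exists_norm_stftFun_le`, by integration by parts). In the second, `ε` depends on `f` only through
the constant `h` of its seminorm, and the bound is linear in the seminorm; this uniformity is what
makes `A u` an ultradistribution. Uniqueness is immediate, as the weak formula prescribes every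
value. -/

/-- The inequality `x^k / k! ≤ e^x` at `x = (δ/θ) s^{1/θ}`, raised to the power `θ`. -/
theorem exists_pow_le_factorial_rpow_mul_exp {θ δ : ℝ} (hθ : 0 < θ) (hδ : 0 < δ) :
    ∃ H : ℝ, 1 ≤ H ∧ ∀ (k : ℕ) (s : ℝ), 0 ≤ s →
      s ^ k ≤ H ^ k * (k ! : ℝ) ^ θ * Real.exp (δ * s ^ (1 / θ)) := by
  refine ⟨max 1 ((θ / δ) ^ θ), le_max_left _ _, fun k s hs => ?_⟩
  set σ : ℝ := s ^ (1 / θ) with hσ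
  have hσ0 : 0 ≤ σ := Real.rpow_nonneg hs _
  have hsσ : s = σ ^ θ := by
    rw [hσ, ← Real.rpow_mul hs, one_div_mul_cancel hθ.ne', Real.rpow_one]
  have h1 := Real.pow_div_factorial_le_exp (x := δ / θ * σ) (by positivity) k
  rw [div_le_iff₀ (by positivity)] at h1
  have h2 : σ ^ k ≤ (θ / δ) ^ k * (Real.exp (δ / θ * σ) * (k ! : ℝ)) := by
    calc σ ^ k = (θ / δ) ^ k * (δ / θ * σ) ^ k := by
          rw [← mul_pow]
          congr 1
          field_simp
      _ ≤ _ := by gcongr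
  have h3 := Real.rpow_le_rpow (by positivity) h2 hθ.le
  rw [Real.mul_rpow (by positivity) (by positivity), Real.mul_rpow (by positivity) (by positivity),
    ← Real.exp_mul, ← Real.rpow_pow_comm hσ0, ← Real.rpow_pow_comm (by positivity), ← hsσ] at h3
  have h4 : δ / θ * σ * θ = δ * σ := by field_simp
  rw [h4] at h3
  calc s ^ k ≤ ((θ / δ) ^ θ) ^ k * (Real.exp (δ * σ) * (k ! : ℝ) ^ θ) := h3
    _ ≤ (max 1 ((θ / δ) ^ θ)) ^ k * (Real.exp (δ * σ) * (k ! : ℝ) ^ θ) := by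
        gcongr
        exact le_max_right _ _
    _ = _ := by ring

/-- Taking `θ`-th roots turns `n!^θ` into `n!`, after which the inequalities are summed as an
exponential series instead of optimizing over `n`. The rate `ε` and the factor `K` depend on `θ` and
`A` only, not on `B`. -/
theorem exists_exp_decay_of_pow_mul_le {θ A : ℝ} (hθ : 0 < θ) (hA : 0 < A) :
    ∃ ε > 0, ∃ K : ℝ, 0 ≤ K ∧ ∀ s w B : ℝ, 0 ≤ s → 0 ≤ w →
      (∀ n : ℕ, s ^ n * w ≤ B * A ^ n * (n ! : ℝ) ^ θ) →
      w ≤ K * B * Real.exp (-ε * s ^ (1 / θ)) := by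
  refine ⟨θ / (2 * A ^ (1 / θ)), by positivity, 2 ^ θ, by positivity, fun s w B hs hw h => ?_⟩
  have hB : 0 ≤ B := by
    have := h 0
    simp only [pow_zero, one_mul, Nat.factorial_zero, Nat.cast_one, Real.one_rpow, mul_one] at this
    exact hw.trans this
  set σ : ℝ := s ^ (1 / θ) with hσ
  have hσ0 : 0 ≤ σ := Real.rpow_nonneg hs _
  set Q : ℝ := A ^ (1 / θ) with hQ
  have hQ0 : 0 < Q := by positivity
  set v : ℝ := w ^ (1 / θ) with hv
  have hv0 : 0 ≤ v := Real.rpow_nonneg hw _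
  set b : ℝ := B ^ (1 / θ) with hb
  have hb0 : 0 ≤ b := Real.rpow_nonneg hB _
  have back : ∀ r : ℝ, 0 ≤ r → (r ^ (1 / θ)) ^ θ = r := fun r hr => by
    rw [← Real.rpow_mul hr, one_div_mul_cancel hθ.ne', Real.rpow_one]
  -- The extra 2 in the denominator leaves a geometric series on the right.
  have h1 : ∀ n : ℕ, (σ / (2 * Q)) ^ n / n ! * v ≤ b * (1 / 2) ^ n := by
    intro n
    have h2 := Real.rpow_le_rpow (by positivity) (h n) (one_div_pos.mpr hθ).le
    rw [Real.mul_rpow (by positivity) hw, Real.mul_rpow (by positivity) (by positivity),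
      Real.mul_rpow hB (by positivity), ← Real.rpow_pow_comm hs, ← Real.rpow_pow_comm hA.le,
      ← Real.rpow_mul (by positivity), mul_one_div_cancel hθ.ne', Real.rpow_one] at h2
    have h3 : (σ / (2 * Q)) ^ n / n ! * v = (σ ^ n * v) / ((2 * Q) ^ n * n !) := by
      rw [div_pow]
      field_simp
    rw [h3, div_le_iff₀ (by positivity)]
    refine h2.trans_eq ?_
    rw [← hb, ← hQ]
    calc b * Q ^ n * (n ! : ℝ) = b * Q ^ n * n ! * (1 / 2 * 2) ^ n := by norm_num
      _ = _ := by
        rw [mul_pow, mul_pow]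
        ring
  have h4 : Real.exp (σ / (2 * Q)) * v ≤ b * 2 := by
    have e1 : HasSum (fun n : ℕ => (σ / (2 * Q)) ^ n / n ! * v) (Real.exp (σ / (2 * Q)) * v) := by
      have := NormedSpace.expSeries_div_hasSum_exp (𝔸 := ℝ) (σ / (2 * Q))
      rw [← Real.exp_eq_exp_ℝ] at this
      exact this.mul_right v
    have e2 : HasSum (fun n : ℕ => b * (1 / 2 : ℝ) ^ n) (b * 2) := hasSum_geometric_two.mul_left b
    exact hasSum_le h1 e1 e2
  have h5 : v ≤ b * 2 * Real.exp (-(σ / (2 * Q))) := by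
    rw [Real.exp_neg, ← div_eq_mul_inv, le_div_iff₀ (Real.exp_pos _)]
    linarith
  have h6 := Real.rpow_le_rpow hv0 h5 hθ.le
  rw [back w hw, Real.mul_rpow (by positivity) (by positivity), Real.mul_rpow hb0 (by norm_num),
    back B hB, ← Real.exp_mul] at h6
  refine h6.trans_eq ?_
  rw [mul_comm B]
  congr 2
  field_simp

theorem integrable_exp_neg_mul_norm_rpow {E : Type*} [NormedAddCommGroup E] [NormedSpace ℝ E]
    [FiniteDimensional ℝ E] [MeasurableSpace E] [BorelSpace E] (μ : Measure E)
    [μ.IsAddHaarMeasure] {θ ε : ℝ} (hθ : 0 < θ) (hε : 0 < ε) :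
    Integrable (fun p : E => Real.exp (-ε * ‖p‖ ^ (1 / θ))) μ := by
  obtain ⟨H, hH1, hH⟩ := exists_pow_le_factorial_rpow_mul_exp hθ hε
  set N : ℕ := Module.finrank ℝ E + 1 with hN
  have hint := integrable_one_add_norm (E := E) (μ := μ) (r := (N : ℝ))
    (by rw [hN]; push_cast; linarith)
  have hc : Continuous fun p : E => Real.exp (-ε * ‖p‖ ^ (1 / θ)) := by
    refine Real.continuous_exp.comp (continuous_const.mul ?_)
    exact continuous_norm.rpow_const fun _ => Or.inr (by positivity)
  refine (hint.const_mul (2 ^ (N - 1) * (1 + H ^ N * (N ! : ℝ) ^ θ))).mono'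
    hc.aestronglyMeasurable (Filter.Eventually.of_forall fun p => ?_)
  rw [Real.norm_of_nonneg (Real.exp_pos _).le, Real.rpow_neg (by positivity), Real.rpow_natCast,
    ← div_eq_mul_inv, le_div_iff₀ (by positivity), neg_mul, Real.exp_neg, mul_comm,
    ← div_eq_mul_inv, div_le_iff₀ (Real.exp_pos _), mul_assoc]
  refine (add_pow_le zero_le_one (norm_nonneg p) N).trans ?_
  gcongr
  rw [add_mul, one_mul, one_pow]
  exact add_le_add (Real.one_le_exp (by positivity)) (hH N ‖p‖ (norm_nonneg _))

/-- This is how `1/θ ≤ 2` enters the comparison of Gaussians with the weights `e^{s^{1/θ}}`. -/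
theorem rpow_le_one_add_sq {θ : ℝ} (hθ : 1 / 2 ≤ θ) {s : ℝ} (hs : 0 ≤ s) :
    s ^ (1 / θ) ≤ 1 + s ^ 2 := by
  have h0 : 0 < θ := by linarith
  rcases le_total s 1 with h | h
  · have := Real.rpow_le_one hs h (one_div_pos.mpr h0).le
    nlinarith [sq_nonneg s]
  · have h2 : s ^ (1 / θ) ≤ s ^ (2 : ℝ) := by
      refine Real.rpow_le_rpow_of_exponent_le h ?_
      rw [div_le_iff₀ h0]
      linarith
    rw [Real.rpow_two] at h2
    linarith

theorem add_rpow_le_four_mul {θ : ℝ} (hθ : 1 / 2 ≤ θ) {s t : ℝ} (hs : 0 ≤ s) (ht : 0 ≤ t) :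
    (s + t) ^ (1 / θ) ≤ 4 * (s ^ (1 / θ) + t ^ (1 / θ)) := by
  have h0 : 0 < θ := by linarith
  have hi : 0 ≤ 1 / θ := (one_div_pos.mpr h0).le
  have hi2 : 1 / θ ≤ 2 := by
    rw [div_le_iff₀ h0]
    linarith
  have key : ∀ r : ℝ, 0 ≤ r → (2 * r) ^ (1 / θ) ≤ 4 * r ^ (1 / θ) := fun r hr => by
    rw [Real.mul_rpow (by norm_num) hr]
    gcongr
    calc (2 : ℝ) ^ (1 / θ) ≤ 2 ^ (2 : ℝ) := Real.rpow_le_rpow_of_exponent_le (by norm_num) hi2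
      _ = 4 := by norm_num
  have hs' : 0 ≤ s ^ (1 / θ) := Real.rpow_nonneg hs _
  have ht' : 0 ≤ t ^ (1 / θ) := Real.rpow_nonneg ht _
  rcases le_total s t with h | h
  · have := Real.rpow_le_rpow (by positivity) (show s + t ≤ 2 * t by linarith) hi
    linarith [key t ht]
  · have := Real.rpow_le_rpow (by positivity) (show s + t ≤ 2 * s by linarith) hi
    linarith [key s hs]

theorem sqrt_factorial_le_rpow {θ : ℝ} (hθ : 1 / 2 ≤ θ) (m : ℕ) :
    √(m ! : ℝ) ≤ (m ! : ℝ) ^ θ := by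
  rw [Real.sqrt_eq_rpow]
  exact Real.rpow_le_rpow_of_exponent_le (by exact_mod_cast m.factorial_pos) hθ

theorem factorial_rpow_mul_le {θ : ℝ} (hθ : 0 ≤ θ) (k l : ℕ) :
    (k ! : ℝ) ^ θ * (l ! : ℝ) ^ θ ≤ ((k + l)! : ℝ) ^ θ := by
  rw [← Real.mul_rpow (by positivity) (by positivity)]
  refine Real.rpow_le_rpow (by positivity) ?_ hθ
  exact_mod_cast Nat.le_of_dvd (Nat.factorial_pos _)
    (Nat.factorial_mul_factorial_dvd_factorial_add k l)

/-! ### Seminorms of Gabor atoms -/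

theorem contDiff_fbiKernel {d : ℕ} (z : Cd d) : ContDiff ℝ ∞ (fbiKernel z) :=
  (fbiKernel_mem le_rfl z).1

/-- Completing the square exhibits the atom as a modulation times a translated Gaussian. Estimating
`kernelOne` directly at large `z` would cost a factor `e^{3|z|²}`. -/
theorem exp_smul_kernelOne_eq (x ξ : ℝ) :
    (Complex.exp (-(x : ℂ) ^ 2 / 2)) • kernelOne (-(ξ : ℂ) - Complex.I * x) =
      (fun w : ℂ => Complex.exp (-(Complex.I * ξ) * w)) * fun w => kernelOne 0 (w - x) := by
  funext w
  simp only [kernelOne, Pi.smul_apply, Pi.mul_apply, smul_eq_mul]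
  rw [← Complex.exp_add, ← Complex.exp_add]
  congr 1
  linear_combination (-(x : ℂ) * w) * Complex.I_mul_I

/-- Split `|t| ≤ |x| + |t - x|`: the second part is absorbed by the Gaussian centred at `x`, the
first is paid for by `E`, which will be `e^{δ|x|^{1/θ}}`. -/
theorem abs_pow_mul_norm_iteratedDeriv_kernelOne_sub_le {θ : ℝ} (hθ : 1 / 2 ≤ θ) {H E : ℝ}
    (hH : 1 ≤ H) (hE : 1 ≤ E) (x t : ℝ) (a m : ℕ) (hx : |x| ^ a ≤ H ^ a * (a ! : ℝ) ^ θ * E) :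
    |t| ^ a * ‖iteratedDeriv m (kernelOne 0) ((t : ℂ) - x)‖ ≤
      2 * Real.exp 2 * (2 * H * Real.exp 2) ^ a * Real.exp 2 ^ m * (a ! : ℝ) ^ θ *
        (m ! : ℝ) ^ θ * E := by
  have h1 : |t| ^ a ≤ 2 ^ a * (|x| ^ a + |t - x| ^ a) := by
    have e1 : |t| ≤ |x| + |t - x| := by
      have := abs_add_le x (t - x)
      rwa [add_sub_cancel] at this
    calc |t| ^ a ≤ (|x| + |t - x|) ^ a := by gcongr
      _ ≤ 2 ^ (a - 1) * (|x| ^ a + |t - x| ^ a) := add_pow_le (abs_nonneg _) (abs_nonneg _) a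
      _ ≤ _ := by
          gcongr
          · norm_num
          · omega
  have h2 := kernelOne_bound 0 0 m (t - x)
  have h3 := kernelOne_bound 0 a m (t - x)
  push_cast at h2 h3
  simp only [pow_zero, one_mul, norm_zero, ne_eq, OfNat.ofNat_ne_zero, not_false_eq_true, zero_pow,
    mul_zero, zero_add, Nat.factorial_zero, Nat.cast_one, Real.sqrt_one, mul_one] at h2 h3
  set F : ℝ := ‖iteratedDeriv m (kernelOne 0) ((t : ℂ) - x)‖
  have hF : 0 ≤ F := norm_nonneg _
  have hm := sqrt_factorial_le_rpow hθ m
  have ha := sqrt_factorial_le_rpow hθ a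
  have he : 1 ≤ Real.exp 2 := Real.one_le_exp (by norm_num)
  set S : ℝ := Real.exp 2 * (H * Real.exp 2) ^ a * Real.exp 2 ^ m * (a ! : ℝ) ^ θ *
        (m ! : ℝ) ^ θ * E with hS
  have h4 : |x| ^ a * F ≤ S := by
    calc |x| ^ a * F ≤ (H ^ a * (a ! : ℝ) ^ θ * E) * (Real.exp 2 * Real.exp 2 ^ m * √(m ! : ℝ)) := by
          gcongr
      _ ≤ ((H * Real.exp 2) ^ a * (a ! : ℝ) ^ θ * E) *
            (Real.exp 2 * Real.exp 2 ^ m * (m ! : ℝ) ^ θ) := by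
          gcongr
          exact le_mul_of_one_le_right (by positivity) he
      _ = S := by rw [hS]; ring
  have h5 : |t - x| ^ a * F ≤ S := by
    calc |t - x| ^ a * F ≤ Real.exp 2 * Real.exp 2 ^ (a + m) * √(a ! : ℝ) * √(m ! : ℝ) := h3
      _ = Real.exp 2 * (1 * Real.exp 2) ^ a * Real.exp 2 ^ m * √(a ! : ℝ) * √(m ! : ℝ) * 1 := by
          rw [pow_add]; ring
      _ ≤ S := by
          rw [hS]
          gcongr
  calc |t| ^ a * F ≤ 2 ^ a * (|x| ^ a + |t - x| ^ a) * F := by gcongr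
    _ = 2 ^ a * (|x| ^ a * F + |t - x| ^ a * F) := by ring
    _ ≤ 2 ^ a * (S + S) := by gcongr
    _ = _ := by rw [hS, mul_assoc 2 H, mul_pow 2]; ring

/-- Leibniz' rule for modulation times translated Gaussian: derivatives of the modulation give
powers of `ξ`, position weights give powers of `x`, and both become `e^{δ|·|^{1/θ}}`. The growth
rate `δ` is arbitrary at the price of a large `h`. -/
theorem exists_kernelOne_shift_bound {θ δ : ℝ} (hθ : 1 / 2 ≤ θ) (hδ : 0 < δ) :
    ∃ h : ℝ, 0 < h ∧ ∃ M : ℝ, 0 ≤ M ∧ ∀ (x ξ t : ℝ) (a b : ℕ),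
      |t| ^ a * (Real.exp (-x ^ 2 / 2) *
        ‖iteratedDeriv b (kernelOne (-(ξ : ℂ) - Complex.I * x)) (t : ℂ)‖) ≤
      M * Real.exp (δ * (|x| ^ (1 / θ) + |ξ| ^ (1 / θ))) * h ^ (a + b) * (a ! : ℝ) ^ θ *
        (b ! : ℝ) ^ θ := by
  have hθ0 : 0 < θ := by linarith
  obtain ⟨H, hH1, hH⟩ := exists_pow_le_factorial_rpow_mul_exp hθ0 hδ
  -- The 2 in the rate absorbs both the factor `2^a` of the splitting of `|t|^a` and the sum `2^b`
  -- of the binomial coefficients.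
  refine ⟨2 * H * Real.exp 2, by positivity, 2 * Real.exp 2, by positivity,
    fun x ξ t a b => ?_⟩
  have he : 1 ≤ Real.exp 2 := Real.one_le_exp (by norm_num)
  have hE : 1 ≤ Real.exp (δ * |x| ^ (1 / θ)) := Real.one_le_exp (by positivity)
  have hd1 : ContDiffAt ℂ b (fun w : ℂ => Complex.exp (-(Complex.I * ξ) * w)) (t : ℂ) := by
    fun_prop
  have hd2 : ContDiffAt ℂ b (fun w : ℂ => kernelOne 0 (w - x)) (t : ℂ) := by
    unfold kernelOne
    fun_prop
  have h1 : iteratedDeriv b ((Complex.exp (-(x : ℂ) ^ 2 / 2)) •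
        kernelOne (-(ξ : ℂ) - Complex.I * x)) (t : ℂ) =
      Complex.exp (-(x : ℂ) ^ 2 / 2) *
        iteratedDeriv b (kernelOne (-(ξ : ℂ) - Complex.I * x)) (t : ℂ) := by
    rw [iteratedDeriv_const_smul_field, smul_eq_mul]
  have h2 : ‖Complex.exp (-(x : ℂ) ^ 2 / 2)‖ = Real.exp (-x ^ 2 / 2) := by
    rw [Complex.norm_exp]
    norm_cast
  rw [← h2, ← norm_mul, ← h1, exp_smul_kernelOne_eq, iteratedDeriv_mul hd1 hd2]
  set P : ℝ := 2 * Real.exp 2 * (2 * H * Real.exp 2) ^ a * (a ! : ℝ) ^ θ *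
    Real.exp (δ * |x| ^ (1 / θ)) with hP
  have hP0 : 0 ≤ P := by positivity
  have hterm : ∀ i ∈ Finset.range (b + 1),
      |t| ^ a * ‖(b.choose i : ℂ) *
        iteratedDeriv i (fun w : ℂ => Complex.exp (-(Complex.I * ξ) * w)) (t : ℂ) *
        iteratedDeriv (b - i) (fun w : ℂ => kernelOne 0 (w - x)) (t : ℂ)‖ ≤
      (b.choose i : ℝ) * (P * (H * Real.exp 2) ^ b * (b ! : ℝ) ^ θ *
        Real.exp (δ * |ξ| ^ (1 / θ))) := by
    intro i hi
    have hib : i ≤ b := by simpa [Nat.lt_succ_iff] using hi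
    rw [iteratedDeriv_cexp_const_mul, iteratedDeriv_comp_sub_const]
    have e1 : ‖(-(Complex.I * ξ)) ^ i * Complex.exp (-(Complex.I * ξ) * t)‖ = |ξ| ^ i := by
      have : -(Complex.I * ξ) * t = ((-(ξ * t) : ℝ) : ℂ) * Complex.I := by push_cast; ring
      rw [this, norm_mul, Complex.norm_exp_ofReal_mul_I]
      simp
    have e2 := abs_pow_mul_norm_iteratedDeriv_kernelOne_sub_le hθ hH1 hE x t a (b - i)
      (hH a |x| (abs_nonneg _))
    have e3 := hH i |ξ| (abs_nonneg _)
    have e4 := factorial_rpow_mul_le hθ0.le i (b - i)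
    rw [Nat.add_sub_cancel' hib] at e4
    rw [norm_mul, norm_mul, e1, Complex.norm_natCast]
    have e5 : H ^ i * Real.exp 2 ^ (b - i) ≤ (H * Real.exp 2) ^ b := by
      rw [mul_pow]
      exact mul_le_mul (pow_le_pow_right₀ hH1 hib) (pow_le_pow_right₀ he (Nat.sub_le b i))
        (by positivity) (by positivity)
    calc |t| ^ a * ((b.choose i : ℝ) * |ξ| ^ i *
          ‖iteratedDeriv (b - i) (kernelOne 0) ((t : ℂ) - x)‖)
        = (b.choose i : ℝ) * (|ξ| ^ i *
          (|t| ^ a * ‖iteratedDeriv (b - i) (kernelOne 0) ((t : ℂ) - x)‖)) := by ring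
      _ ≤ (b.choose i : ℝ) * ((H ^ i * (i ! : ℝ) ^ θ * Real.exp (δ * |ξ| ^ (1 / θ))) *
          (2 * Real.exp 2 * (2 * H * Real.exp 2) ^ a * Real.exp 2 ^ (b - i) * (a ! : ℝ) ^ θ *
            ((b - i)! : ℝ) ^ θ * Real.exp (δ * |x| ^ (1 / θ)))) := by gcongr
      _ = (b.choose i : ℝ) * (P * (H ^ i * Real.exp 2 ^ (b - i)) *
          ((i ! : ℝ) ^ θ * ((b - i)! : ℝ) ^ θ) * Real.exp (δ * |ξ| ^ (1 / θ))) := by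
          rw [hP]; ring
      _ ≤ _ := by gcongr
  calc _ ≤ ∑ i ∈ Finset.range (b + 1), |t| ^ a * ‖(b.choose i : ℂ) *
        iteratedDeriv i (fun w : ℂ => Complex.exp (-(Complex.I * ξ) * w)) (t : ℂ) *
        iteratedDeriv (b - i) (fun w : ℂ => kernelOne 0 (w - x)) (t : ℂ)‖ := by
        rw [← Finset.mul_sum]
        gcongr
        exact norm_sum_le _ _
    _ ≤ _ := Finset.sum_le_sum hterm
    _ = 2 ^ b * (P * (H * Real.exp 2) ^ b * (b ! : ℝ) ^ θ *
        Real.exp (δ * |ξ| ^ (1 / θ))) := by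
        rw [← Finset.sum_mul]
        congr 1
        exact_mod_cast Nat.sum_range_choose b
    _ = _ := by
        rw [hP, mul_add, Real.exp_add, pow_add, mul_assoc 2 H, mul_pow 2 _ b]
        ring

theorem chi_apply {d : ℕ} (p : Rd d × Rd d) (j : Fin d) :
    chi p j = -(p.2 j : ℂ) - Complex.I * (p.1 j : ℂ) := rfl

theorem multiDeriv_smul_fbiKernel {d : ℕ} (c : ℂ) (z : Cd d) (β : Fin d → ℕ) (y : Rd d) :
    multiDeriv β (c • fbiKernel z) y =
      c * ∏ j, iteratedDeriv (β j) (kernelOne (z j)) (y j : ℂ) := by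
  rw [(multiDeriv_linear β (contDiff_fbiKernel z) (contDiff_fbiKernel z) c).2, Pi.smul_apply,
    smul_eq_mul, multiDeriv_fbiKernel]

/-- For tensor products the multi-index estimate factorizes over the coordinates. -/
theorem GSBound_of_prod {d : ℕ} {θ h M c : ℝ} {f : Rd d → ℂ} (hc : 0 ≤ c)
    {g : Fin d → ℕ → ℝ → ℂ}
    (hf : ∀ β y, ‖multiDeriv β f y‖ ≤ c * ∏ j, ‖g j (β j) (y j)‖)
    (hg : ∀ j a b t, |t| ^ a * ‖g j b t‖ ≤
      M * h ^ (a + b) * (a ! : ℝ) ^ θ * (b ! : ℝ) ^ θ) :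
    GSBound θ h (c * M ^ d) f := by
  intro α β y
  have h1 : c * M ^ d * h ^ (∑ i, α i + ∑ i, β i) * ((∏ i, (α i)! : ℕ) : ℝ) ^ θ *
      ((∏ i, (β i)! : ℕ) : ℝ) ^ θ =
      c * ∏ j, (M * h ^ (α j + β j) * ((α j)! : ℝ) ^ θ * ((β j)! : ℝ) ^ θ) := by
    push_cast
    rw [← Real.finsetProd_rpow _ _ (fun j _ => by positivity),
      ← Real.finsetProd_rpow _ _ (fun j _ => by positivity), ← Finset.sum_add_distrib,
      ← Finset.prod_pow_eq_pow_sum, Finset.prod_mul_distrib, Finset.prod_mul_distrib,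
      Finset.prod_mul_distrib, Finset.prod_const, Finset.card_univ, Fintype.card_fin]
    ring
  rw [h1, norm_mul, Complex.norm_real, norm_prod]
  calc (∏ i, ‖y i ^ α i‖) * ‖multiDeriv β f y‖
      ≤ (∏ i, ‖y i ^ α i‖) * (c * ∏ j, ‖g j (β j) (y j)‖) := by
        gcongr
        exact hf β y
    _ = c * ∏ j, (|y j| ^ α j * ‖g j (β j) (y j)‖) := by
        rw [Finset.prod_mul_distrib]
        simp only [norm_pow, Real.norm_eq_abs]
        ring
    _ ≤ _ := by
        refine mul_le_mul_of_nonneg_left ?_ hc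
        exact Finset.prod_le_prod (fun j _ => by positivity) fun j _ => hg j (α j) (β j) (y j)

theorem exists_GSBound_gaborAtom (d : ℕ) {θ δ : ℝ} (hθ : 1 / 2 ≤ θ) (hδ : 0 < δ) :
    ∃ h : ℝ, 0 < h ∧ ∃ M : ℝ, 0 ≤ M ∧ ∀ p : Rd d × Rd d,
      GSBound θ h (M * Real.exp (δ * ‖p‖ ^ (1 / θ))) (gaborAtom p) := by
  have hθ0 : 0 < θ := by linarith
  -- Each of the `d` coordinates contributes a rate `2δ'`, so the total is at most `δ`; the summand
  -- 1 keeps the denominator positive when `d = 0`.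
  set δ' : ℝ := δ / (2 * d + 1) with hδ'
  have hδ'0 : 0 < δ' := by positivity
  obtain ⟨h, hh, M, hM, hb⟩ := exists_kernelOne_shift_bound hθ hδ'0
  refine ⟨h, hh, Real.pi ^ (-(d : ℝ) / 4) * M ^ d, by positivity, fun p => ?_⟩
  have hexp : ∀ j : Fin d, |p.1 j| ^ (1 / θ) + |p.2 j| ^ (1 / θ) ≤ 2 * ‖p‖ ^ (1 / θ) := by
    intro j
    have i1 : |p.1 j| ≤ ‖p‖ := (PiLp.norm_apply_le p.1 j).trans (norm_fst_le p)
    have i2 : |p.2 j| ≤ ‖p‖ := (PiLp.norm_apply_le p.2 j).trans (norm_snd_le p)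
    have hp : (0 : ℝ) ≤ 1 / θ := by positivity
    have := Real.rpow_le_rpow (abs_nonneg _) i1 hp
    have := Real.rpow_le_rpow (abs_nonneg _) i2 hp
    linarith
  have key : GSBound θ h (Real.pi ^ (-(d : ℝ) / 4) *
      (M * Real.exp (δ' * (2 * ‖p‖ ^ (1 / θ)))) ^ d) (gaborAtom p) := by
    refine GSBound_of_prod (by positivity) (g := fun j b t => (Real.exp (-(p.1 j) ^ 2 / 2) : ℂ) *
      iteratedDeriv b (kernelOne (chi p j)) (t : ℂ)) (fun β y => ?_) (fun j a b t => ?_)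
    · rw [gaborAtom_eq, multiDeriv_smul_fbiKernel, ← norm_prod, Finset.prod_mul_distrib,
        norm_mul, norm_mul, Complex.norm_real, norm_mul, mul_assoc, Real.norm_of_nonneg (by positivity),
        Real.norm_of_nonneg (by positivity)]
      refine le_of_eq ?_
      congr 2
      rw [← Complex.ofReal_prod, Complex.norm_real, Real.norm_of_nonneg (by positivity),
        ← Real.exp_sum, EuclideanSpace.real_norm_sq_eq]
      congr 1
      rw [neg_div, Finset.sum_div, ← Finset.sum_neg_distrib]
      exact Finset.sum_congr rfl fun j _ => by ring
    · rw [norm_mul, Complex.norm_real, Real.norm_of_nonneg (by positivity), chi_apply]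
      refine (hb _ _ _ _ _).trans ?_
      gcongr
      exact hexp j
  have hle : Real.pi ^ (-(d : ℝ) / 4) * (M * Real.exp (δ' * (2 * ‖p‖ ^ (1 / θ)))) ^ d ≤
      Real.pi ^ (-(d : ℝ) / 4) * M ^ d * Real.exp (δ * ‖p‖ ^ (1 / θ)) := by
    rw [mul_pow, ← mul_assoc, ← Real.exp_nat_mul]
    refine mul_le_mul_of_nonneg_left (Real.exp_le_exp.mpr ?_) (by positivity)
    have : δ = (2 * d + 1) * δ' := by rw [hδ']; field_simp
    rw [this]
    have : 0 ≤ δ' * ‖p‖ ^ (1 / θ) := by positivity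
    nlinarith
  intro α β y
  refine (key α β y).trans ?_
  gcongr

/-- Continuity of `u` holds for every `h`, in particular for the large one that a small `δ`
requires. -/
theorem exists_norm_stftDual_le {d : ℕ} {θ : ℝ} (hθ : 1 / 2 ≤ θ) (u : GSDual θ d) {δ : ℝ}
    (hδ : 0 < δ) :
    ∃ C : ℝ, 0 ≤ C ∧ ∀ p, ‖stftDual hθ u p‖ ≤ C * Real.exp (δ * ‖p‖ ^ (1 / θ)) := by
  obtain ⟨h, hh, M, hM, hb⟩ := exists_GSBound_gaborAtom d hθ hδ
  obtain ⟨K, hK⟩ := u.2 h hh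
  refine ⟨(2 * Real.pi) ^ (-(d : ℝ) / 2) * (|K| * M), by positivity, fun p => ?_⟩
  rw [stftDual, norm_mul, Complex.norm_real, Real.norm_of_nonneg (by positivity), mul_assoc]
  gcongr
  refine (hK ⟨gaborAtom p, gaborAtom_mem hθ p⟩ _ (hb p)).trans ?_
  rw [← mul_assoc]
  gcongr
  exact le_abs_self K

/-! ### Continuity of the short-time Fourier transform of an ultradistribution -/

/-- Cauchy's estimate on the circle of radius `√(b+1)`: the Gaussian growth then costs only a
geometric factor in `b`, and `b!/r^b ≤ √b!`. -/
theorem norm_iteratedDeriv_le_of_gaussian_growth {g : ℂ → ℂ} (hg : Differentiable ℂ g) {D : ℝ}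
    {c : ℂ} (hD : ∀ w, ‖g w‖ ≤ D * Real.exp (3 * ‖w - c‖ ^ 2)) (b : ℕ) :
    ‖iteratedDeriv b g c‖ ≤ D * Real.exp 3 * Real.exp 3 ^ b * √(b ! : ℝ) := by
  set r : ℝ := √((b : ℝ) + 1) with hr
  have hr0 : 0 < r := Real.sqrt_pos.mpr (by positivity)
  have hr2 : r ^ 2 = (b : ℝ) + 1 := Real.sq_sqrt (by positivity)
  have hD0 : 0 ≤ D := by
    have := (norm_nonneg _).trans (hD c)
    simpa using this
  have h1 := Complex.norm_iteratedDeriv_le_of_forall_mem_sphere_norm_le b hr0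
    (f := g) (c := c) hg.diffContOnCl (C := D * Real.exp (3 * r ^ 2))
    (fun w hw => by
      have := hD w
      rwa [← dist_eq_norm, Metric.mem_sphere.mp hw] at this)
  have h2 : (b ! : ℝ) / r ^ b ≤ √(b ! : ℝ) := by
    rw [div_le_iff₀ (by positivity)]
    have h3 : √(b ! : ℝ) ≤ r ^ b := by
      refine Real.sqrt_le_iff.mpr ⟨by positivity, ?_⟩
      rw [← pow_mul, mul_comm b 2, pow_mul, hr2]
      calc (b ! : ℝ) ≤ (b : ℝ) ^ b := by exact_mod_cast Nat.factorial_le_pow b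
        _ ≤ _ := by gcongr; linarith
    calc (b ! : ℝ) = √(b ! : ℝ) * √(b ! : ℝ) := (Real.mul_self_sqrt (by positivity)).symm
      _ ≤ _ := by gcongr
  have h4 : Real.exp (3 * r ^ 2) = Real.exp 3 * Real.exp 3 ^ b := by
    rw [← Real.exp_nat_mul, ← Real.exp_add, hr2]
    congr 1
    ring
  calc _ ≤ (b ! : ℝ) * (D * Real.exp (3 * r ^ 2)) / r ^ b := h1
    _ = D * Real.exp (3 * r ^ 2) * ((b ! : ℝ) / r ^ b) := by ring
    _ ≤ D * Real.exp (3 * r ^ 2) * √(b ! : ℝ) := by gcongr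
    _ = _ := by rw [h4]; ring

/-- Mean value inequality in the parameter `z`. Differentiation produces a factor `i w`, absorbed by
weakening the decay from `t²/8` to `t²/16` and the growth in `|w - t|` from `2r²` to `3r²`. -/
theorem norm_kernelOne_sub_le {R : ℝ} {z z' : ℂ} (hz : ‖z‖ ≤ R) (hz' : ‖z'‖ ≤ R) (t : ℝ) (w : ℂ) :
    ‖kernelOne z w - kernelOne z' w‖ ≤
      ‖z - z'‖ * Real.exp (3 * R ^ 2 + 5) * Real.exp (-(1 / 16 * |t| ^ 2)) *
        Real.exp (3 * ‖w - t‖ ^ 2) := by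
  set r : ℝ := ‖w - t‖ with hr
  have hr0 : 0 ≤ r := norm_nonneg _
  have hd : ∀ ζ : ℂ, HasDerivAt (fun ζ => kernelOne ζ w) (kernelOne ζ w * (Complex.I * w)) ζ := by
    intro ζ
    unfold kernelOne
    have : HasDerivAt (fun ζ : ℂ => Complex.I * ζ * w - w ^ 2 / 2) (Complex.I * w) ζ := by
      simpa using (((hasDerivAt_id ζ).const_mul Complex.I).mul_const w).sub_const (w ^ 2 / 2)
    exact this.cexp
  have hw : ‖w‖ ≤ Real.exp (1 / 16 * |t| ^ 2 + r ^ 2 + 5) := by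
    have e1 : ‖w‖ ≤ r + |t| := by
      have := norm_add_le (w - t) (t : ℂ)
      simpa [hr] using this
    have e2 := Real.add_one_le_exp (1 / 16 * |t| ^ 2 + r ^ 2 + 5)
    nlinarith [sq_nonneg (|t| / 4 - 2), sq_nonneg (r - 1 / 2)]
  have hb : ∀ ζ ∈ Metric.closedBall (0 : ℂ) R, ‖kernelOne ζ w * (Complex.I * w)‖ ≤
      Real.exp (3 * R ^ 2 + 5) * Real.exp (-(1 / 16 * |t| ^ 2)) * Real.exp (3 * r ^ 2) := by
    intro ζ hζ
    have hζ' : ‖ζ‖ ≤ R := by simpa using hζ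
    have hsq : ‖ζ‖ ^ 2 ≤ R ^ 2 := by gcongr
    have e1 := norm_kernelOne_le ζ t r w rfl
    rw [norm_mul, norm_mul, Complex.norm_I, one_mul]
    refine (mul_le_mul e1 hw (norm_nonneg _) (Real.exp_pos _).le).trans ?_
    rw [← Real.exp_add, ← Real.exp_add, ← Real.exp_add]
    refine Real.exp_le_exp.mpr ?_
    have := sq_abs t
    nlinarith
  have := (convex_closedBall (0 : ℂ) R).norm_image_sub_le_of_norm_hasDerivWithin_le
    (fun ζ _ => (hd ζ).hasDerivWithinAt) hb (show z' ∈ _ by simpa using hz')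
    (show z ∈ _ by simpa using hz)
  refine this.trans_eq ?_
  ring

theorem exists_kernelOne_sub_bound (R : ℝ) :
    ∃ h : ℝ, 0 < h ∧ ∃ M : ℝ, 0 ≤ M ∧ ∀ z z' : ℂ, ‖z‖ ≤ R → ‖z'‖ ≤ R → ∀ (a b : ℕ) (t : ℝ),
      |t| ^ a * ‖iteratedDeriv b (kernelOne z) (t : ℂ) - iteratedDeriv b (kernelOne z') (t : ℂ)‖ ≤
        ‖z - z'‖ * (M * h ^ (a + b) * √(a ! : ℝ) * √(b ! : ℝ)) ∧
      |t| ^ a * ‖iteratedDeriv b (kernelOne z) (t : ℂ)‖ ≤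
        M * h ^ (a + b) * √(a ! : ℝ) * √(b ! : ℝ) := by
  obtain ⟨H, hH1, hH⟩ := exists_pow_le_factorial_rpow_mul_exp (θ := 1 / 2) (δ := 1 / 16)
    (by norm_num) (by norm_num)
  refine ⟨H * Real.exp 3, by positivity, Real.exp (3 * R ^ 2 + 5) * Real.exp 3, by positivity,
    fun z z' hz hz' a b t => ⟨?_, ?_⟩⟩
  · have hdiff : ∀ z, ContDiffAt ℂ b (kernelOne z) (t : ℂ) := fun z =>
      ((contDiff_kernelOne z).of_le le_top).contDiffAt
    have h1 : iteratedDeriv b (kernelOne z) (t : ℂ) - iteratedDeriv b (kernelOne z') (t : ℂ) =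
        iteratedDeriv b (kernelOne z - kernelOne z') (t : ℂ) :=
      (iteratedDeriv_sub (hdiff z) (hdiff z')).symm
    have h2 := norm_iteratedDeriv_le_of_gaussian_growth (g := kernelOne z - kernelOne z')
      (((contDiff_kernelOne z).differentiable (by simp)).sub
        ((contDiff_kernelOne z').differentiable (by simp)))
      (fun w => norm_kernelOne_sub_le hz hz' t w) b
    have h3 := hH a |t| (abs_nonneg _)
    have h4 : |t| ^ (1 / (1 / 2 : ℝ)) = |t| ^ 2 := by
      rw [one_div_one_div, Real.rpow_two]
    rw [h4, ← Real.sqrt_eq_rpow] at h3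
    have h5 : |t| ^ a * Real.exp (-(1 / 16 * |t| ^ 2)) ≤ H ^ a * √(a ! : ℝ) := by
      rw [Real.exp_neg, ← div_eq_mul_inv, div_le_iff₀ (Real.exp_pos _)]
      exact h3
    have he : 1 ≤ Real.exp 3 := Real.one_le_exp (by norm_num)
    rw [h1]
    calc _ ≤ |t| ^ a * (‖z - z'‖ * Real.exp (3 * R ^ 2 + 5) * Real.exp (-(1 / 16 * |t| ^ 2)) *
          Real.exp 3 * Real.exp 3 ^ b * √(b ! : ℝ)) := by gcongr
      _ = ‖z - z'‖ * (Real.exp (3 * R ^ 2 + 5) * Real.exp 3 *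
          ((|t| ^ a * Real.exp (-(1 / 16 * |t| ^ 2))) * (1 * Real.exp 3) ^ b) * √(b ! : ℝ)) := by
          ring
      _ ≤ ‖z - z'‖ * (Real.exp (3 * R ^ 2 + 5) * Real.exp 3 *
          (((H * Real.exp 3) ^ a * √(a ! : ℝ)) * (H * Real.exp 3) ^ b) * √(b ! : ℝ)) := by
          have h8 := h5.trans (show H ^ a * √(a ! : ℝ) ≤ (H * Real.exp 3) ^ a * √(a ! : ℝ) by
            gcongr
            exact le_mul_of_one_le_right (by positivity) he)
          refine mul_le_mul_of_nonneg_left (mul_le_mul_of_nonneg_right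
            (mul_le_mul_of_nonneg_left (mul_le_mul h8 ?_ (by positivity) (by positivity))
              (by positivity)) (by positivity)) (by positivity)
          gcongr
      _ = _ := by rw [pow_add]; ring
  · refine (kernelOne_bound z a b t).trans ?_
    have hsq : ‖z‖ ^ 2 ≤ R ^ 2 := by gcongr
    have h6 : Real.exp 2 ≤ H * Real.exp 3 := by
      calc Real.exp 2 ≤ 1 * Real.exp 3 := by
            rw [one_mul]
            exact Real.exp_le_exp.mpr (by norm_num)
        _ ≤ _ := by gcongr
    have h7 : Real.exp (3 * ‖z‖ ^ 2 + 2) ≤ Real.exp (3 * R ^ 2 + 5) * Real.exp 3 := by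
      rw [← Real.exp_add]
      exact Real.exp_le_exp.mpr (by linarith)
    gcongr

/-- Telescoping, one factor at a time. A relative difference `δ` in each factor keeps the full
product of the `c i` on the right. -/
theorem norm_prod_sub_prod_le_of_relative {ι : Type*} (s : Finset ι) {a b : ι → ℂ} {c : ι → ℝ}
    {δ : ℝ} (hδ : 0 ≤ δ) (ha : ∀ i, ‖a i‖ ≤ c i) (hb : ∀ i, ‖b i‖ ≤ c i)
    (hab : ∀ i, ‖a i - b i‖ ≤ δ * c i) :
    ‖∏ i ∈ s, a i - ∏ i ∈ s, b i‖ ≤ s.card * δ * ∏ i ∈ s, c i := by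
  classical
  have hc : ∀ i, 0 ≤ c i := fun i => (norm_nonneg _).trans (ha i)
  induction s using Finset.induction_on with
  | empty => simp
  | insert j s hj ih =>
    rw [Finset.prod_insert hj, Finset.prod_insert hj, Finset.prod_insert hj,
      Finset.card_insert_of_notMem hj]
    have h1 : a j * ∏ i ∈ s, a i - b j * ∏ i ∈ s, b i =
        (a j - b j) * ∏ i ∈ s, a i + b j * (∏ i ∈ s, a i - ∏ i ∈ s, b i) := by ring
    have h2 : ‖∏ i ∈ s, a i‖ ≤ ∏ i ∈ s, c i := by
      rw [norm_prod]
      exact Finset.prod_le_prod (fun _ _ => norm_nonneg _) fun i _ => ha i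
    have hP : 0 ≤ ∏ i ∈ s, c i := Finset.prod_nonneg fun i _ => hc i
    rw [h1]
    refine (norm_add_le _ _).trans ?_
    rw [norm_mul, norm_mul]
    calc _ ≤ (δ * c j) * ∏ i ∈ s, c i + c j * (s.card * δ * ∏ i ∈ s, c i) :=
          add_le_add (mul_le_mul (hab j) h2 (norm_nonneg _) (mul_nonneg hδ (hc j)))
            (mul_le_mul (hb j) ih (norm_nonneg _) (hc j))
      _ = _ := by push_cast; ring

/-- The kernel is Lipschitz in `z` on bounded sets for a single seminorm, so a single continuity
constant of `u` suffices. -/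
theorem exists_GSBound_fbiKernel_sub (d : ℕ) {θ : ℝ} (hθ : 1 / 2 ≤ θ) (R : ℝ) :
    ∃ h : ℝ, 0 < h ∧ ∃ M : ℝ, 0 ≤ M ∧ ∀ z z' : Cd d, ‖z‖ ≤ R → ‖z'‖ ≤ R →
      GSBound θ h (M * ‖z - z'‖) (fbiKernel z - fbiKernel z') := by
  obtain ⟨h, hh, M, hM, hb⟩ := exists_kernelOne_sub_bound R
  refine ⟨h, hh, d * M ^ d, by positivity, fun z z' hz hz' α β y => ?_⟩
  have hsub : multiDeriv β (fbiKernel z - fbiKernel z') y =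
      ∏ j, iteratedDeriv (β j) (kernelOne (z j)) (y j : ℂ) -
        ∏ j, iteratedDeriv (β j) (kernelOne (z' j)) (y j : ℂ) := by
    have e1 : fbiKernel z - fbiKernel z' = fbiKernel z + (-1 : ℂ) • fbiKernel z' := by
      rw [neg_one_smul, sub_eq_add_neg]
    have e2 : ContDiff ℝ ∞ ((-1 : ℂ) • fbiKernel z') := contDiff_const.smul (contDiff_fbiKernel z')
    rw [e1, (multiDeriv_linear β (contDiff_fbiKernel z) e2 0).1, Pi.add_apply, multiDeriv_fbiKernel,
      multiDeriv_smul_fbiKernel]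
    ring
  have hz1 : ∀ j, ‖z j‖ ≤ R := fun j => (PiLp.norm_apply_le z j).trans hz
  have hz2 : ∀ j, ‖z' j‖ ≤ R := fun j => (PiLp.norm_apply_le z' j).trans hz'
  have hpow : ∀ j, ‖((y j ^ α j : ℝ) : ℂ)‖ = |y j| ^ α j := fun j => by
    rw [Complex.norm_real, norm_pow, Real.norm_eq_abs]
  have key := norm_prod_sub_prod_le_of_relative Finset.univ (norm_nonneg (z - z'))
    (a := fun j => ((y j ^ α j : ℝ) : ℂ) * iteratedDeriv (β j) (kernelOne (z j)) (y j : ℂ))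
    (b := fun j => ((y j ^ α j : ℝ) : ℂ) * iteratedDeriv (β j) (kernelOne (z' j)) (y j : ℂ))
    (c := fun j => M * h ^ (α j + β j) * √((α j)! : ℝ) * √((β j)! : ℝ))
    (fun j => by
      rw [norm_mul, hpow]
      exact (hb _ _ (hz1 j) (hz2 j) _ _ _).2)
    (fun j => by
      rw [norm_mul, hpow]
      exact (hb _ _ (hz2 j) (hz1 j) _ _ _).2)
    (fun j => by
      rw [← mul_sub, norm_mul, hpow]
      refine (hb _ _ (hz1 j) (hz2 j) _ _ _).1.trans ?_
      gcongr
      exact PiLp.norm_apply_le (z - z') j)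
  rw [hsub, mul_sub, Complex.ofReal_prod, ← Finset.prod_mul_distrib, ← Finset.prod_mul_distrib]
  refine key.trans ?_
  rw [Finset.card_univ, Fintype.card_fin]
  push_cast
  rw [← Real.finsetProd_rpow _ _ (fun j _ => by positivity),
    ← Real.finsetProd_rpow _ _ (fun j _ => by positivity), ← Finset.sum_add_distrib,
    ← Finset.prod_pow_eq_pow_sum, Finset.prod_mul_distrib, Finset.prod_mul_distrib,
    Finset.prod_mul_distrib, Finset.prod_const, Finset.card_univ, Fintype.card_fin]
  have e2 : ∏ j, √((α j)! : ℝ) ≤ ∏ j, ((α j)! : ℝ) ^ θ :=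
    Finset.prod_le_prod (fun _ _ => by positivity) fun j _ => sqrt_factorial_le_rpow hθ _
  have e3 : ∏ j, √((β j)! : ℝ) ≤ ∏ j, ((β j)! : ℝ) ^ θ :=
    Finset.prod_le_prod (fun _ _ => by positivity) fun j _ => sqrt_factorial_le_rpow hθ _
  calc _ = d * M ^ d * ‖z - z'‖ * (∏ j, h ^ (α j + β j)) * (∏ j, √((α j)! : ℝ)) *
        ∏ j, √((β j)! : ℝ) := by ring
    _ ≤ _ := by gcongr

theorem continuous_apply_fbiKernel {d : ℕ} {θ : ℝ} (hθ : 1 / 2 ≤ θ) (u : GSDual θ d) :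
    Continuous fun z : Cd d => u.1 ⟨fbiKernel z, fbiKernel_mem hθ z⟩ := by
  refine continuous_iff_continuousAt.mpr fun z₀ => ?_
  obtain ⟨h, hh, M, hM, hb⟩ := exists_GSBound_fbiKernel_sub d hθ (‖z₀‖ + 1)
  obtain ⟨K, hK⟩ := u.2 h hh
  refine tendsto_iff_norm_sub_tendsto_zero.mpr ?_
  have hlim : Filter.Tendsto (fun z : Cd d => K * (M * ‖z - z₀‖)) (nhds z₀) (nhds 0) := by
    have : Continuous fun z : Cd d => K * (M * ‖z - z₀‖) := by fun_prop
    simpa using this.tendsto z₀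
  refine squeeze_zero' (Filter.Eventually.of_forall fun _ => norm_nonneg _) ?_ hlim
  filter_upwards [Metric.ball_mem_nhds z₀ one_pos] with z hz
  rw [← map_sub]
  refine hK _ _ (hb z z₀ ?_ (by linarith))
  rw [Metric.mem_ball, dist_eq_norm] at hz
  have := norm_sub_norm_le z z₀
  linarith

theorem continuous_chi {d : ℕ} : Continuous (chi : Rd d × Rd d → Cd d) := by
  unfold chi
  fun_prop

theorem stftDual_eq {d : ℕ} {θ : ℝ} (hθ : 1 / 2 ≤ θ) (u : GSDual θ d) (p : Rd d × Rd d) :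
    stftDual hθ u p = (((2 * Real.pi) ^ (-(d : ℝ) / 2) : ℝ) : ℂ) *
      ((((Real.pi ^ (-(d : ℝ) / 4) * Real.exp (-‖p.1‖ ^ 2 / 2) : ℝ)) : ℂ) *
        u.1 ⟨fbiKernel (chi p), fbiKernel_mem hθ (chi p)⟩) := by
  have h : (⟨gaborAtom p, gaborAtom_mem hθ p⟩ : GS θ d) =
      (((Real.pi ^ (-(d : ℝ) / 4) * Real.exp (-‖p.1‖ ^ 2 / 2) : ℝ)) : ℂ) •
        ⟨fbiKernel (chi p), fbiKernel_mem hθ (chi p)⟩ := Subtype.ext (gaborAtom_eq p)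
  rw [stftDual, h, map_smul, smul_eq_mul]

/-- Serves the measurability of the integrand defining the localization operator. -/
theorem continuous_stftDual {d : ℕ} {θ : ℝ} (hθ : 1 / 2 ≤ θ) (u : GSDual θ d) :
    Continuous (stftDual hθ u) := by
  have h : stftDual hθ u = _ := funext (stftDual_eq hθ u)
  rw [h]
  have h1 := (continuous_apply_fbiKernel hθ u).comp (continuous_chi (d := d))
  have h2 : Continuous fun p : Rd d × Rd d =>
      (((Real.pi ^ (-(d : ℝ) / 4) * Real.exp (-‖p.1‖ ^ 2 / 2) : ℝ)) : ℂ) := by fun_prop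
  exact continuous_const.mul (h2.mul h1)

/-! ### Decay of the short-time Fourier transform of a Gelfand-Shilov function -/

/-- The Gaussian `e^{-|y|²/2}` differentiated along the multi-index `n`, translated by `x` and
modulated by `e^{-i⟨ξ,y⟩}`, with `p = (x,ξ)`. -/
noncomputable def gaborDeriv {d : ℕ} (n : Fin d → ℕ) (p : Rd d × Rd d) (y : Rd d) : ℂ :=
  (∏ i, iteratedDeriv (n i) (kernelOne ((0 : Cd d) i)) ((y - p.1) i : ℂ)) *
    Complex.exp (-(Complex.I * (inner ℝ p.2 y : ℝ)))

theorem gaborAtom_eq_gaborDeriv {d : ℕ} (p : Rd d × Rd d) (y : Rd d) :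
    gaborAtom p y = ((Real.pi ^ (-(d : ℝ) / 4) : ℝ) : ℂ) * gaborDeriv 0 p y := by
  have h : ∏ i, iteratedDeriv ((0 : Fin d → ℕ) i) (kernelOne ((0 : Cd d) i)) ((y - p.1) i : ℂ) =
      ((Real.exp (-‖y - p.1‖ ^ 2 / 2) : ℝ) : ℂ) := by
    rw [EuclideanSpace.real_norm_sq_eq, neg_div, Finset.sum_div, ← Finset.sum_neg_distrib,
      Real.exp_sum, Complex.ofReal_prod]
    refine Finset.prod_congr rfl fun i _ => ?_
    simp only [Pi.zero_apply, iteratedDeriv_zero, kernelOne, PiLp.zero_apply, mul_zero, zero_mul,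
      zero_sub]
    push_cast
    rfl
  rw [gaborDeriv, h, gaborAtom, gaussWindow]
  push_cast
  ring

theorem contDiff_gaborDeriv {d : ℕ} (n : Fin d → ℕ) (p : Rd d × Rd d) :
    ContDiff ℝ ∞ (gaborDeriv n p) := by
  have h1 := (contDiff_kernel_prod (0 : Cd d) n).comp
    (contDiff_id.sub (contDiff_const (c := p.1)) : ContDiff ℝ ∞ fun y : Rd d => y - p.1)
  have h2 : ContDiff ℝ ∞ fun y : Rd d => Complex.exp (-(Complex.I * (inner ℝ p.2 y : ℝ))) := by
    have : ContDiff ℝ ∞ fun y : Rd d => ((inner ℝ p.2 y : ℝ) : ℂ) :=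
      Complex.ofRealCLM.contDiff.comp (innerSL ℝ p.2).contDiff
    exact ((contDiff_const.mul this).neg).cexp
  exact h1.mul h2

/-- Read as a formula for `iξ_j` times the function: multiplication by the frequency is one more
derivative on the Gaussian minus a full derivative, and the latter can be integrated by parts. -/
theorem partialDeriv_gaborDeriv {d : ℕ} (n : Fin d → ℕ) (p : Rd d × Rd d) (j : Fin d) (y : Rd d) :
    partialDeriv j (gaborDeriv n p) y =
      gaborDeriv (Function.update n j (n j + 1)) p y -
        Complex.I * (p.2 j : ℂ) * gaborDeriv n p y := by
  set G : Rd d → ℂ := fun y => ∏ i, iteratedDeriv (n i) (kernelOne ((0 : Cd d) i)) (y i : ℂ)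
    with hG
  have hG1 : HasFDerivAt G (fderiv ℝ G (y - p.1)) (y - p.1) :=
    ((contDiff_kernel_prod (0 : Cd d) n).differentiable (by simp) _).hasFDerivAt
  have hG2 : HasFDerivAt (fun y => G (y - p.1)) (fderiv ℝ G (y - p.1)) y := by
    have := hG1.comp y ((hasFDerivAt_id y).sub_const p.1)
    rwa [ContinuousLinearMap.comp_id] at this
  have hi : HasFDerivAt (fun y : Rd d => -(Complex.I * ((inner ℝ p.2 y : ℝ) : ℂ)))
      (-(Complex.I • Complex.ofRealCLM.comp (innerSL ℝ p.2))) y := by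
    have h0 : HasFDerivAt (fun y : Rd d => ((inner ℝ p.2 y : ℝ) : ℂ))
        (Complex.ofRealCLM.comp (innerSL ℝ p.2)) y :=
      (Complex.ofRealCLM.comp (innerSL ℝ p.2)).hasFDerivAt
    exact (h0.const_mul Complex.I).neg
  have h := hG2.mul hi.cexp
  have h2 := congrFun (partialDeriv_prod (0 : Cd d) n j) (y - p.1)
  simp only [partialDeriv] at h2 ⊢
  have h3 : gaborDeriv n p = fun y => G (y - p.1) *
      Complex.exp (-(Complex.I * ((inner ℝ p.2 y : ℝ) : ℂ))) := rfl
  rw [h3]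
  have h4 := h.fderiv
  rw [show (fun y => G (y - p.1) * Complex.exp (-(Complex.I * ((inner ℝ p.2 y : ℝ) : ℂ)))) =
    (fun y => G (y - p.1)) * fun y => Complex.exp (-(Complex.I * ((inner ℝ p.2 y : ℝ) : ℂ)))
    from rfl, h4]
  simp only [add_apply, smul_apply, neg_apply, ContinuousLinearMap.comp_apply, innerSL_apply_apply,
    Complex.ofRealCLM_apply, smul_eq_mul, Pi.mul_apply]
  rw [hG, h2, EuclideanSpace.inner_single_right]
  simp only [gaborDeriv, conj_trivial, one_mul]
  ring

theorem norm_iteratedDeriv_kernelOne_zero_le (b : ℕ) (t : ℝ) :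
    ‖iteratedDeriv b (kernelOne 0) (t : ℂ)‖ ≤
      Real.exp (-t ^ 2 / 8) * Real.exp 3 * Real.exp 3 ^ b * √(b ! : ℝ) := by
  refine norm_iteratedDeriv_le_of_gaussian_growth
    ((contDiff_kernelOne 0).differentiable (by simp)) (fun w => ?_) b
  refine (norm_kernelOne_le 0 t _ w rfl).trans ?_
  rw [← Real.exp_add, norm_zero]
  refine Real.exp_le_exp.mpr ?_
  nlinarith [sq_nonneg ‖w - t‖]

theorem sum_single_nat {d : ℕ} (j : Fin d) (l : ℕ) :
    ∑ i, (Pi.single j l : Fin d → ℕ) i = l := by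
  simp

theorem prod_single_factorial {d : ℕ} (j : Fin d) (l : ℕ) :
    ∏ i, ((Pi.single j l : Fin d → ℕ) i)! = l ! := by
  rw [Finset.prod_eq_single j]
  · simp
  · intro i _ hi
    simp [hi]
  · simp

theorem norm_gaborDeriv_single_le {d : ℕ} (j : Fin d) (l : ℕ) (p : Rd d × Rd d) (y : Rd d) :
    ‖gaborDeriv (Pi.single j l) p y‖ ≤
      Real.exp 3 ^ d * Real.exp 3 ^ l * √(l ! : ℝ) * Real.exp (-‖y - p.1‖ ^ 2 / 8) := by
  have h1 : ‖Complex.exp (-(Complex.I * (inner ℝ p.2 y : ℝ)))‖ = 1 := by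
    rw [Complex.norm_exp]
    simp
  rw [gaborDeriv, norm_mul, h1, mul_one, norm_prod]
  calc _ ≤ ∏ i, (Real.exp (-((y - p.1) i) ^ 2 / 8) * Real.exp 3 *
        Real.exp 3 ^ (Pi.single j l : Fin d → ℕ) i *
          √(((Pi.single j l : Fin d → ℕ) i)! : ℝ)) :=
        Finset.prod_le_prod (fun _ _ => norm_nonneg _)
          fun i _ => norm_iteratedDeriv_kernelOne_zero_le _ _
    _ = _ := by
        have h2 : ∏ i, √(((Pi.single j l : Fin d → ℕ) i)! : ℝ) = √(l ! : ℝ) := by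
          rw [Finset.prod_eq_single j]
          · simp
          · intro i _ hi
            simp [hi]
          · simp
        rw [Finset.prod_mul_distrib, Finset.prod_mul_distrib, Finset.prod_mul_distrib, h2,
          ← Real.exp_sum, Finset.prod_pow_eq_pow_sum, sum_single_nat, Finset.prod_const,
          Finset.card_univ, Fintype.card_fin, EuclideanSpace.real_norm_sq_eq, neg_div,
          Finset.sum_div, ← Finset.sum_neg_distrib]
        simp only [neg_div]
        ring

theorem norm_gaborDeriv_zero_le {d : ℕ} (p : Rd d × Rd d) (y : Rd d) :
    ‖gaborDeriv 0 p y‖ ≤ Real.exp 3 ^ d * Real.exp (-‖y - p.1‖ ^ 2 / 8) := by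
  have h1 : ‖Complex.exp (-(Complex.I * (inner ℝ p.2 y : ℝ)))‖ = 1 := by
    rw [Complex.norm_exp]
    simp
  rw [gaborDeriv, norm_mul, h1, mul_one, norm_prod]
  calc _ ≤ ∏ i, (Real.exp (-((y - p.1) i) ^ 2 / 8) * Real.exp 3) :=
        Finset.prod_le_prod (fun _ _ => norm_nonneg _) fun i _ => by
          simpa using norm_iteratedDeriv_kernelOne_zero_le 0 ((y - p.1) i)
    _ = _ := by
        rw [Finset.prod_mul_distrib, ← Real.exp_sum, Finset.prod_const,
          Finset.card_univ, Fintype.card_fin, EuclideanSpace.real_norm_sq_eq, neg_div,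
          Finset.sum_div, ← Finset.sum_neg_distrib]
        simp only [neg_div]
        ring

theorem integrable_gaussian (d : ℕ) {b : ℝ} (hb : 0 < b) :
    Integrable fun y : Rd d => Real.exp (-b * ‖y‖ ^ 2) := by
  have h := GaussianFourier.integrable_cexp_neg_mul_sq_norm_add (V := Rd d) (b := (b : ℂ))
    (by simpa using hb) 0 0
  refine h.norm.congr (Filter.Eventually.of_forall fun y => ?_)
  simp only [zero_mul, add_zero, Complex.norm_exp]
  norm_cast

theorem integrable_gaussian_sub (d : ℕ) {b : ℝ} (hb : 0 < b) (x : Rd d) :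
    Integrable fun y : Rd d => Real.exp (-b * ‖y - x‖ ^ 2) :=
  (integrable_gaussian d hb).comp_sub_right x

/-! ### One-coordinate consequences of the seminorm bound. -/

theorem multiDeriv_zero {d : ℕ} (f : Rd d → ℂ) : multiDeriv 0 f = f := by
  unfold multiDeriv
  induction List.finRange d with
  | nil => rfl
  | cons i l ih => simp

theorem multiDeriv_single {d : ℕ} (j : Fin d) (k : ℕ) (f : Rd d → ℂ) :
    multiDeriv (Pi.single j k) f = (partialDeriv j)^[k] f := by
  have main : ∀ l : List (Fin d), l.Nodup →
      l.foldr (fun i g => (partialDeriv i)^[(Pi.single j k : Fin d → ℕ) i] g) f =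
      if j ∈ l then (partialDeriv j)^[k] f else f := by
    intro l hl
    induction l with
    | nil => simp
    | cons i l ih =>
      rw [List.nodup_cons] at hl
      rw [List.foldr_cons, ih hl.2]
      by_cases hij : i = j
      · subst hij
        simp [hl.1]
      · simp [hij, Ne.symm hij]
  simpa [multiDeriv] using main _ (List.nodup_finRange d)

theorem GSBound.norm_iterate_partialDeriv_le {d : ℕ} {θ h M : ℝ} {f : Rd d → ℂ}
    (hf : GSBound θ h M f) (j : Fin d) (k : ℕ) (y : Rd d) :
    ‖(partialDeriv j)^[k] f y‖ ≤ M * h ^ k * (k ! : ℝ) ^ θ := by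
  have := hf 0 (Pi.single j k) y
  rw [multiDeriv_single, sum_single_nat, prod_single_factorial] at this
  simpa using this

theorem GSBound.abs_pow_mul_norm_le {d : ℕ} {θ h M : ℝ} {f : Rd d → ℂ}
    (hf : GSBound θ h M f) (j : Fin d) (n : ℕ) (y : Rd d) :
    |y j| ^ n * ‖f y‖ ≤ M * h ^ n * (n ! : ℝ) ^ θ := by
  have := hf (Pi.single j n) 0 y
  rw [multiDeriv_zero, sum_single_nat, prod_single_factorial] at this
  have h2 : ∏ i, y i ^ (Pi.single j n : Fin d → ℕ) i = y j ^ n := by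
    rw [Finset.prod_eq_single j]
    · simp
    · intro i _ hi
      simp [hi]
    · simp
  rw [h2, norm_mul, Complex.norm_real, norm_pow, Real.norm_eq_abs] at this
  simpa using this

theorem GSBound.norm_le {d : ℕ} {θ h M : ℝ} {f : Rd d → ℂ} (hf : GSBound θ h M f) (y : Rd d) :
    ‖f y‖ ≤ M := by
  have := hf 0 0 y
  rw [multiDeriv_zero] at this
  simpa using this

/-- Here `c = iξ_j`, and `W k l` carries `k` derivatives on `f` and `l` on the Gaussian. Each factor
`c` puts one more derivative on one of the two, so `n` factors give `2^n` terms of total order `k +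
l + n`. -/
theorem norm_pow_mul_le_of_recurrence {W : ℕ → ℕ → ℂ} {c : ℂ} {A B θ : ℝ}
    (hrec : ∀ k l, c * W k l = W (k + 1) l + W k (l + 1))
    (hW : ∀ k l, ‖W k l‖ ≤ B * A ^ (k + l) * ((k + l)! : ℝ) ^ θ) (n k l : ℕ) :
    ‖c‖ ^ n * ‖W k l‖ ≤ B * 2 ^ n * A ^ (k + l + n) * ((k + l + n)! : ℝ) ^ θ := by
  induction n generalizing k l with
  | zero => simpa using hW k l
  | succ n ih =>
    have h1 : ‖c‖ * ‖W k l‖ ≤ ‖W (k + 1) l‖ + ‖W k (l + 1)‖ := by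
      rw [← norm_mul, hrec]
      exact norm_add_le _ _
    have h2 := ih (k + 1) l
    have h3 := ih k (l + 1)
    rw [show k + 1 + l + n = k + l + (n + 1) by ring] at h2
    rw [show k + (l + 1) + n = k + l + (n + 1) by ring] at h3
    calc ‖c‖ ^ (n + 1) * ‖W k l‖ = ‖c‖ ^ n * (‖c‖ * ‖W k l‖) := by ring
      _ ≤ ‖c‖ ^ n * (‖W (k + 1) l‖ + ‖W k (l + 1)‖) := by gcongr
      _ = ‖c‖ ^ n * ‖W (k + 1) l‖ + ‖c‖ ^ n * ‖W k (l + 1)‖ := by ring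
      _ ≤ _ := add_le_add h2 h3
      _ = _ := by ring

/-- The first alternative is there for `d = 0`, where no coordinate exists. -/
theorem norm_le_card_mul_coord {d : ℕ} (x : Rd d) : ‖x‖ = 0 ∨ ∃ j, ‖x‖ ≤ d * |x j| := by
  by_contra hcon
  push Not at hcon
  obtain ⟨h0, hlt⟩ := hcon
  rcases Nat.eq_zero_or_pos d with hd | hd
  · subst hd
    exact h0 (by rw [Subsingleton.elim x 0, norm_zero])
  · have : Nonempty (Fin d) := ⟨⟨0, hd⟩⟩
    have hpos : 0 < ‖x‖ := lt_of_le_of_ne (norm_nonneg _) (Ne.symm h0)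
    have h1 : ∑ j, (d * |x j|) ^ 2 < ∑ _j : Fin d, ‖x‖ ^ 2 := by
      refine Finset.sum_lt_sum_of_nonempty Finset.univ_nonempty fun j _ => ?_
      have := hlt j
      gcongr
    have h2 : ∑ j, (d * |x j|) ^ 2 = (d : ℝ) ^ 2 * ‖x‖ ^ 2 := by
      rw [EuclideanSpace.real_norm_sq_eq, Finset.mul_sum]
      exact Finset.sum_congr rfl fun j _ => by rw [mul_pow, sq_abs]
    rw [h2, Finset.sum_const, Finset.card_univ, Fintype.card_fin, nsmul_eq_mul] at h1
    have h3 : (1 : ℝ) ≤ d := by exact_mod_cast hd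
    have h5 : (d : ℝ) * ‖x‖ ^ 2 ≤ (d : ℝ) ^ 2 * ‖x‖ ^ 2 := by
      rw [sq (d : ℝ), mul_assoc]
      exact le_mul_of_one_le_left (by positivity) h3
    exact absurd h1 (not_lt.mpr h5)

/-! ### Weighted estimates of the transform in frequency and position. -/

section
variable {d : ℕ} {θ h M : ℝ} {f : Rd d → ℂ}

theorem norm_integral_le_of_gaussian_bound {F : Rd d → ℂ} {D : ℝ} (x : Rd d)
    (hF : ∀ y, ‖F y‖ ≤ D * Real.exp (-(1 / 16) * ‖y - x‖ ^ 2)) :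
    ‖∫ y, F y‖ ≤ D * ∫ y : Rd d, Real.exp (-(1 / 16) * ‖y‖ ^ 2) := by
  calc _ ≤ ∫ y : Rd d, D * Real.exp (-(1 / 16) * ‖y - x‖ ^ 2) :=
        norm_integral_le_of_norm_le ((integrable_gaussian_sub d (by norm_num) x).const_mul D)
          (Filter.Eventually.of_forall hF)
    _ = _ := by
        rw [integral_const_mul,
          integral_sub_right_eq_self (fun y : Rd d => Real.exp (-(1 / 16) * ‖y‖ ^ 2)) x]

theorem neg_sq_div_eight_le (s : ℝ) : -s ^ 2 / 8 ≤ -(1 / 16) * s ^ 2 := by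
  nlinarith [sq_nonneg s]

theorem norm_iterate_mul_gaborDeriv_le (hθ : 1 / 2 ≤ θ) (hh : 0 < h) (hb : GSBound θ h M f)
    (p : Rd d × Rd d) (j : Fin d) (k l : ℕ) (y : Rd d) :
    ‖(partialDeriv j)^[k] f y * gaborDeriv (Pi.single j l) p y‖ ≤
      M * Real.exp 3 ^ d * (max h (Real.exp 3)) ^ (k + l) * ((k + l)! : ℝ) ^ θ *
        Real.exp (-(1 / 16) * ‖y - p.1‖ ^ 2) := by
  have hM := hb.nonneg
  have hθ0 : 0 ≤ θ := by linarith
  rw [norm_mul]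
  calc _ ≤ (M * h ^ k * (k ! : ℝ) ^ θ) * (Real.exp 3 ^ d * Real.exp 3 ^ l * √(l ! : ℝ) *
        Real.exp (-‖y - p.1‖ ^ 2 / 8)) :=
        mul_le_mul (hb.norm_iterate_partialDeriv_le j k y) (norm_gaborDeriv_single_le j l p y)
          (norm_nonneg _) (by positivity)
    _ ≤ (M * (max h (Real.exp 3)) ^ k * (k ! : ℝ) ^ θ) *
        (Real.exp 3 ^ d * (max h (Real.exp 3)) ^ l * (l ! : ℝ) ^ θ *
          Real.exp (-(1 / 16) * ‖y - p.1‖ ^ 2)) := by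
        gcongr
        · exact le_max_left _ _
        · exact le_max_right _ _
        · exact sqrt_factorial_le_rpow hθ l
        · exact neg_sq_div_eight_le _
    _ = M * Real.exp 3 ^ d * (max h (Real.exp 3)) ^ (k + l) * ((k ! : ℝ) ^ θ * (l ! : ℝ) ^ θ) *
        Real.exp (-(1 / 16) * ‖y - p.1‖ ^ 2) := by rw [pow_add]; ring
    _ ≤ _ := by
        gcongr
        exact factorial_rpow_mul_le hθ0 k l

theorem integrable_iterate_mul_gaborDeriv (hθ : 1 / 2 ≤ θ) (hf : ContDiff ℝ ∞ f) (hh : 0 < h)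
    (hb : GSBound θ h M f) (p : Rd d × Rd d) (j : Fin d) (k l : ℕ) :
    Integrable fun y => (partialDeriv j)^[k] f y * gaborDeriv (Pi.single j l) p y :=
  ((integrable_gaussian_sub d (by norm_num) p.1).const_mul _).mono'
    ((contDiff_iterate_partialDeriv j k hf).continuous.mul
      (contDiff_gaborDeriv _ p).continuous).aestronglyMeasurable
    (Filter.Eventually.of_forall fun y => norm_iterate_mul_gaborDeriv_le hθ hh hb p j k l y)

/-- Integration by parts in `y_j`; the Gaussian factor makes all products integrable, so no boundary
term appears. -/
theorem frequency_mul_integral_gaborDeriv (hθ : 1 / 2 ≤ θ) (hf : ContDiff ℝ ∞ f) (hh : 0 < h)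
    (hb : GSBound θ h M f) (p : Rd d × Rd d) (j : Fin d) (k l : ℕ) :
    Complex.I * (p.2 j : ℂ) * ∫ y, (partialDeriv j)^[k] f y * gaborDeriv (Pi.single j l) p y =
      (∫ y, (partialDeriv j)^[k + 1] f y * gaborDeriv (Pi.single j l) p y) +
        ∫ y, (partialDeriv j)^[k] f y * gaborDeriv (Pi.single j (l + 1)) p y := by
  have hint := integrable_iterate_mul_gaborDeriv hθ hf hh hb p j
  have hd : ∀ y, fderiv ℝ (gaborDeriv (Pi.single j l) p) y (EuclideanSpace.single j 1) =
      gaborDeriv (Pi.single j (l + 1)) p y -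
        Complex.I * (p.2 j : ℂ) * gaborDeriv (Pi.single j l) p y := fun y => by
    have := partialDeriv_gaborDeriv (Pi.single j l) p j y
    rwa [Pi.single_eq_same, Pi.single, Function.update_idem] at this
  have hprod : ∀ y, (partialDeriv j)^[k] f y *
      fderiv ℝ (gaborDeriv (Pi.single j l) p) y (EuclideanSpace.single j 1) =
      (partialDeriv j)^[k] f y * gaborDeriv (Pi.single j (l + 1)) p y -
        Complex.I * (p.2 j : ℂ) *
          ((partialDeriv j)^[k] f y * gaborDeriv (Pi.single j l) p y) := fun y => by
    rw [hd]
    ring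
  have hsucc : ∀ y, fderiv ℝ ((partialDeriv j)^[k] f) y (EuclideanSpace.single j 1) =
      (partialDeriv j)^[k + 1] f y := fun y => by
    rw [Function.iterate_succ_apply']
    rfl
  have key := integral_mul_fderiv_eq_neg_fderiv_mul_of_integrable (μ := (volume : Measure (Rd d)))
    (f := (partialDeriv j)^[k] f) (g := gaborDeriv (Pi.single j l) p)
    (v := EuclideanSpace.single j 1)
    (by simpa only [hsucc] using hint (k + 1) l)
    (by
      simp only [hprod]
      exact (hint k (l + 1)).sub ((hint k l).const_mul _))
    (hint k l)
    (fun x _ => (contDiff_iterate_partialDeriv j k hf).differentiable (by simp) x)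
    (fun x _ => (contDiff_gaborDeriv _ p).differentiable (by simp) x)
  simp only [hprod, hsucc] at key
  rw [integral_sub (hint k (l + 1)) ((hint k l).const_mul _), integral_const_mul] at key
  linear_combination -key

theorem abs_frequency_pow_mul_norm_integral_le (hθ : 1 / 2 ≤ θ) (hf : ContDiff ℝ ∞ f) (hh : 0 < h)
    (hb : GSBound θ h M f) (p : Rd d × Rd d) (j : Fin d) (n : ℕ) :
    |p.2 j| ^ n * ‖∫ y, f y * gaborDeriv 0 p y‖ ≤
      M * Real.exp 3 ^ d * (∫ y : Rd d, Real.exp (-(1 / 16) * ‖y‖ ^ 2)) *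
        (2 * max h (Real.exp 3)) ^ n * (n ! : ℝ) ^ θ := by
  have h1 := norm_pow_mul_le_of_recurrence
    (W := fun k l => ∫ y, (partialDeriv j)^[k] f y * gaborDeriv (Pi.single j l) p y)
    (c := Complex.I * (p.2 j : ℂ))
    (B := M * Real.exp 3 ^ d * ∫ y : Rd d, Real.exp (-(1 / 16) * ‖y‖ ^ 2))
    (A := max h (Real.exp 3)) (θ := θ)
    (frequency_mul_integral_gaborDeriv hθ hf hh hb p j)
    (fun k l => by
      refine (norm_integral_le_of_gaussian_bound p.1
        (norm_iterate_mul_gaborDeriv_le hθ hh hb p j k l)).trans_eq ?_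
      ring) n 0 0
  simp only [norm_mul, Complex.norm_I, one_mul, Complex.norm_real, Real.norm_eq_abs,
    Function.iterate_zero, id_eq, Pi.single_zero, zero_add] at h1
  refine h1.trans_eq ?_
  rw [mul_pow]
  ring

/-- Split `|x_j| ≤ |y_j| + |y_j - x_j|`: powers of `y_j` are controlled by the seminorm of `f`,
powers of `y_j - x_j` by half of the Gaussian exponent `1/8`. The other half is kept for
integrability. -/
theorem abs_position_pow_mul_norm_integral_le {H : ℝ} (hθ : 1 / 2 ≤ θ) (hh : 0 < h)
    (hH0 : 1 ≤ H)
    (hH : ∀ (k : ℕ) (s : ℝ), 0 ≤ s → s ^ k ≤ H ^ k * √(k ! : ℝ) * Real.exp (1 / 16 * s ^ 2))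
    (hb : GSBound θ h M f) (p : Rd d × Rd d) (j : Fin d) (n : ℕ) :
    |p.1 j| ^ n * ‖∫ y, f y * gaborDeriv 0 p y‖ ≤
      2 * M * Real.exp 3 ^ d * (∫ y : Rd d, Real.exp (-(1 / 16) * ‖y‖ ^ 2)) *
        (2 * max h H) ^ n * (n ! : ℝ) ^ θ := by
  have hM := hb.nonneg
  have h1 : ∀ y : Rd d, |p.1 j| ^ n ≤ 2 ^ n * (|y j| ^ n + |(y - p.1) j| ^ n) := fun y => by
    have e1 : |p.1 j| ≤ |y j| + |(y - p.1) j| := by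
      have := abs_sub (y j) ((y - p.1) j)
      simpa using this
    calc |p.1 j| ^ n ≤ (|y j| + |(y - p.1) j|) ^ n := by gcongr
      _ ≤ 2 ^ (n - 1) * (|y j| ^ n + |(y - p.1) j| ^ n) :=
          add_pow_le (abs_nonneg _) (abs_nonneg _) n
      _ ≤ _ := by
          gcongr
          · norm_num
          · omega
  have h2 : ∀ y : Rd d, ‖((|p.1 j| ^ n : ℝ) : ℂ) * (f y * gaborDeriv 0 p y)‖ ≤
      2 * M * Real.exp 3 ^ d * (2 * max h H) ^ n * (n ! : ℝ) ^ θ *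
        Real.exp (-(1 / 16) * ‖y - p.1‖ ^ 2) := fun y => by
    set s : ℝ := |(y - p.1) j| with hs
    have hsn : s ≤ ‖y - p.1‖ := PiLp.norm_apply_le (y - p.1) j
    set r : ℝ := ‖y - p.1‖ with hr
    set S : ℝ := M * Real.exp 3 ^ d * (max h H) ^ n * (n ! : ℝ) ^ θ *
        Real.exp (-(1 / 16) * r ^ 2) with hS
    have e0 := norm_gaborDeriv_zero_le p y
    have e1 : |y j| ^ n * ‖f y‖ * ‖gaborDeriv 0 p y‖ ≤ S := by
      calc _ ≤ (M * h ^ n * (n ! : ℝ) ^ θ) * (Real.exp 3 ^ d * Real.exp (-r ^ 2 / 8)) :=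
            mul_le_mul (hb.abs_pow_mul_norm_le j n y) e0 (norm_nonneg _) (by positivity)
        _ ≤ (M * (max h H) ^ n * (n ! : ℝ) ^ θ) *
            (Real.exp 3 ^ d * Real.exp (-(1 / 16) * r ^ 2)) := by
            gcongr
            · exact le_max_left _ _
            · exact neg_sq_div_eight_le _
        _ = S := by rw [hS]; ring
    have e2 : s ^ n * Real.exp (-r ^ 2 / 8) ≤
        (max h H) ^ n * (n ! : ℝ) ^ θ * Real.exp (-(1 / 16) * r ^ 2) := by
      calc s ^ n * Real.exp (-r ^ 2 / 8)
          ≤ (H ^ n * √(n ! : ℝ) * Real.exp (1 / 16 * s ^ 2)) * Real.exp (-r ^ 2 / 8) := by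
            gcongr
            exact hH n s (abs_nonneg _)
        _ ≤ ((max h H) ^ n * (n ! : ℝ) ^ θ * Real.exp (1 / 16 * r ^ 2)) *
            Real.exp (-r ^ 2 / 8) := by
            gcongr
            · exact le_max_right _ _
            · exact sqrt_factorial_le_rpow hθ n
        _ = _ := by
            rw [mul_assoc _ (Real.exp _), ← Real.exp_add]
            congr 2
            ring
    have e3 : ‖f y‖ * (s ^ n * ‖gaborDeriv 0 p y‖) ≤ S := by
      calc _ ≤ M * (s ^ n * (Real.exp 3 ^ d * Real.exp (-r ^ 2 / 8))) := by
            gcongr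
            exact hb.norm_le y
        _ = M * Real.exp 3 ^ d * (s ^ n * Real.exp (-r ^ 2 / 8)) := by ring
        _ ≤ M * Real.exp 3 ^ d * ((max h H) ^ n * (n ! : ℝ) ^ θ *
            Real.exp (-(1 / 16) * r ^ 2)) := by gcongr
        _ = S := by rw [hS]; ring
    rw [norm_mul, norm_mul, Complex.norm_real, Real.norm_of_nonneg (by positivity)]
    calc _ ≤ 2 ^ n * (|y j| ^ n + s ^ n) * (‖f y‖ * ‖gaborDeriv 0 p y‖) := by
          gcongr
          exact h1 y
      _ = 2 ^ n * (|y j| ^ n * ‖f y‖ * ‖gaborDeriv 0 p y‖ +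
          ‖f y‖ * (s ^ n * ‖gaborDeriv 0 p y‖)) := by ring
      _ ≤ 2 ^ n * (S + S) := by gcongr
      _ = _ := by rw [hS, mul_pow 2]; ring
  have h3 := norm_integral_le_of_gaussian_bound p.1 h2
  rw [integral_const_mul, norm_mul, Complex.norm_real, Real.norm_of_nonneg (by positivity)] at h3
  refine h3.trans_eq ?_
  ring

end

/-- Factorial bounds on all powers of each coordinate of `p` combine to exponential decay. The order
of quantifiers matters: `ε` and `K` are fixed before `f` and `M`. -/
theorem exists_norm_stftFun_le (d : ℕ) {θ h : ℝ} (hθ : 1 / 2 ≤ θ) (hh : 0 < h) :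
    ∃ ε > 0, ∃ K : ℝ, 0 ≤ K ∧ ∀ (f : Rd d → ℂ) (M : ℝ), ContDiff ℝ ∞ f → GSBound θ h M f →
      ∀ p, ‖stftFun f p‖ ≤ K * M * Real.exp (-ε * ‖p‖ ^ (1 / θ)) := by
  have hθ0 : 0 < θ := by linarith
  obtain ⟨H, hH1, hH⟩ := exists_pow_le_factorial_rpow_mul_exp (θ := 1 / 2) (δ := 1 / 16)
    (by norm_num) (by norm_num)
  have hH' : ∀ (k : ℕ) (s : ℝ), 0 ≤ s →
      s ^ k ≤ H ^ k * √(k ! : ℝ) * Real.exp (1 / 16 * s ^ 2) := fun k s hs => by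
    have := hH k s hs
    rwa [one_div_one_div, Real.rpow_two, ← Real.sqrt_eq_rpow] at this
  set J : ℝ := ∫ y : Rd d, Real.exp (-(1 / 16) * ‖y‖ ^ 2) with hJ
  have hJ0 : 0 ≤ J := integral_nonneg fun _ => (Real.exp_pos _).le
  set A : ℝ := 2 * max h (max H (Real.exp 3)) with hA
  have hA0 : 0 < A := by positivity
  -- The factor `d` comes from replacing the norm by the largest coordinate; `+ 1` keeps the rate
  -- positive when `d = 0`.
  have hdA : 0 < (d + 1) * A := by positivity
  obtain ⟨ε, hε, K, hK0, hK⟩ := exists_exp_decay_of_pow_mul_le hθ0 hdA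
  set c : ℝ := (2 * Real.pi) ^ (-(d : ℝ) / 2) * Real.pi ^ (-(d : ℝ) / 4) with hc
  refine ⟨ε, hε, c * (K * (2 * Real.exp 3 ^ d * J)), by positivity, fun f M hf hb p => ?_⟩
  have hM := hb.nonneg
  set w : ℝ := ‖∫ y, f y * gaborDeriv 0 p y‖ with hw
  have hw0 : 0 ≤ w := norm_nonneg _
  have hsf : ‖stftFun f p‖ = c * w := by
    have : ∀ y, f y * gaborAtom p y = ((Real.pi ^ (-(d : ℝ) / 4) : ℝ) : ℂ) *
        (f y * gaborDeriv 0 p y) := fun y => by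
      rw [gaborAtom_eq_gaborDeriv]
      ring
    simp only [stftFun, this]
    rw [integral_const_mul, norm_mul, norm_mul, Complex.norm_real, Complex.norm_real,
      Real.norm_of_nonneg (by positivity), Real.norm_of_nonneg (by positivity), ← mul_assoc]
  set B : ℝ := 2 * M * Real.exp 3 ^ d * J with hB
  have hB0 : 0 ≤ B := by positivity
  have hx : ∀ j n, |p.1 j| ^ n * w ≤ B * A ^ n * (n ! : ℝ) ^ θ := fun j n => by
    refine (abs_position_pow_mul_norm_integral_le hθ hh hH1 hH' hb p j n).trans ?_
    rw [hA]
    gcongr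
    exact le_max_left _ _
  have hξ : ∀ j n, |p.2 j| ^ n * w ≤ B * A ^ n * (n ! : ℝ) ^ θ := fun j n => by
    refine (abs_frequency_pow_mul_norm_integral_le hθ hf hh hb p j n).trans ?_
    rw [hA, hB]
    gcongr
    · linarith
    · exact le_max_right _ _
  have hone : w ≤ B := by
    have e1 := norm_integral_le_of_gaussian_bound (F := fun y => f y * gaborDeriv 0 p y)
      (D := M * Real.exp 3 ^ d) p.1 (fun y => by
        rw [norm_mul, mul_assoc]
        refine mul_le_mul (hb.norm_le y) ((norm_gaborDeriv_zero_le p y).trans ?_) (norm_nonneg _) hM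
        gcongr
        exact neg_sq_div_eight_le _)
    refine e1.trans ?_
    rw [hB]
    gcongr
    linarith
  have hpow : ∀ n : ℕ, ‖p‖ ^ n * w ≤ B * ((d + 1) * A) ^ n * (n ! : ℝ) ^ θ := by
    intro n
    have hcoord : ∀ t : ℝ, ‖p‖ ≤ d * |t| → |t| ^ n * w ≤ B * A ^ n * (n ! : ℝ) ^ θ →
        ‖p‖ ^ n * w ≤ B * ((d + 1) * A) ^ n * (n ! : ℝ) ^ θ := by
      intro t ht hb
      calc ‖p‖ ^ n * w ≤ ((d + 1) * |t|) ^ n * w := by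
            gcongr
            refine ht.trans ?_
            gcongr
            linarith
        _ = (d + 1) ^ n * (|t| ^ n * w) := by rw [mul_pow]; ring
        _ ≤ (d + 1) ^ n * (B * A ^ n * (n ! : ℝ) ^ θ) := by gcongr
        _ = _ := by rw [mul_pow _ A]; ring
    have hzero : ‖p‖ = 0 → ‖p‖ ^ n * w ≤ B * ((d + 1) * A) ^ n * (n ! : ℝ) ^ θ := by
      intro h0
      rw [h0]
      -- For `n = 0` the left side is `w` itself, since `0^0 = 1`, so the unweighted bound is
      -- needed.
      rcases Nat.eq_zero_or_pos n with rfl | hn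
      · simpa using hone
      · rw [zero_pow hn.ne', zero_mul]
        positivity
    rcases le_total ‖p.1‖ ‖p.2‖ with hle | hle
    · have hp : ‖p‖ = ‖p.2‖ := by rw [Prod.norm_def, max_eq_right hle]
      rcases norm_le_card_mul_coord p.2 with h0 | ⟨j, hj⟩
      · exact hzero (hp.trans h0)
      · exact hcoord _ (hp.trans_le hj) (hξ j n)
    · have hp : ‖p‖ = ‖p.1‖ := by rw [Prod.norm_def, max_eq_left hle]
      rcases norm_le_card_mul_coord p.1 with h0 | ⟨j, hj⟩
      · exact hzero (hp.trans h0)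
      · exact hcoord _ (hp.trans_le hj) (hx j n)
  have := hK ‖p‖ w B (norm_nonneg _) hw0 hpow
  rw [hsf]
  calc c * w ≤ c * (K * B * Real.exp (-ε * ‖p‖ ^ (1 / θ))) := by gcongr
    _ = _ := by rw [hB]; ring

/-! ### Existence of the localization operator -/

theorem conj_gaborAtom {d : ℕ} (p : Rd d × Rd d) (y : Rd d) :
    conj (gaborAtom p y) = gaborAtom (p.1, -p.2) y := by
  simp only [gaborAtom, map_mul, Complex.conj_ofReal, ← Complex.exp_conj, map_neg, Complex.conj_I,
    inner_neg_left, Complex.ofReal_neg]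
  congr 2
  ring

/-- The two conjugations amount to the reflection `ξ ↦ -ξ`; this form is visibly linear in `f`, and
the reflection preserves `‖p‖`. -/
theorem conj_stftFun_conj {d : ℕ} (f : Rd d → ℂ) (p : Rd d × Rd d) :
    conj (stftFun (fun y => conj (f y)) p) = stftFun f (p.1, -p.2) := by
  rw [stftFun, map_mul, Complex.conj_ofReal, ← integral_conj, stftFun]
  simp only [map_mul, Complex.conj_conj, conj_gaborAtom]

theorem continuous_gaborAtom_uncurry {d : ℕ} :
    Continuous fun q : (Rd d × Rd d) × Rd d => gaborAtom q.1 q.2 := by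
  unfold gaborAtom gaussWindow
  fun_prop

theorem norm_gaborAtom {d : ℕ} (p : Rd d × Rd d) (y : Rd d) :
    ‖gaborAtom p y‖ = Real.pi ^ (-(d : ℝ) / 4) * Real.exp (-(1 / 2) * ‖y - p.1‖ ^ 2) := by
  have h1 : ‖Complex.exp (-(Complex.I * (inner ℝ p.2 y : ℝ)))‖ = 1 := by
    rw [Complex.norm_exp]
    simp
  rw [gaborAtom, norm_mul, h1, mul_one, Complex.norm_real, gaussWindow,
    Real.norm_of_nonneg (by positivity)]
  congr 2
  ring

theorem integrable_mul_gaborAtom {d : ℕ} {θ h M : ℝ} {f : Rd d → ℂ} (hf : ContDiff ℝ ∞ f)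
    (hb : GSBound θ h M f) (p : Rd d × Rd d) : Integrable fun y => f y * gaborAtom p y := by
  have hc : Continuous (gaborAtom p) := (gaborAtom_mem le_rfl p).1.continuous
  have hint : Integrable (gaborAtom p) :=
    ((integrable_gaussian_sub d (b := 1 / 2) (by norm_num) p.1).const_mul
      (Real.pi ^ (-(d : ℝ) / 4))).mono' hc.aestronglyMeasurable
      (Filter.Eventually.of_forall fun y => (norm_gaborAtom p y).le)
  exact hint.bdd_mul hf.continuous.aestronglyMeasurable (Filter.Eventually.of_forall hb.norm_le)

theorem integrable_coe_mul_gaborAtom {d : ℕ} {θ : ℝ} (f : GS θ d) (p : Rd d × Rd d) :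
    Integrable fun y => (f : Rd d → ℂ) y * gaborAtom p y := by
  obtain ⟨hf, C, hC, M, hb⟩ := f.2
  exact integrable_mul_gaborAtom hf hb p

theorem stftFun_add {d : ℕ} {θ : ℝ} (f g : GS θ d) (p : Rd d × Rd d) :
    stftFun ((f + g : GS θ d) : Rd d → ℂ) p =
      stftFun (f : Rd d → ℂ) p + stftFun (g : Rd d → ℂ) p := by
  simp only [stftFun, Submodule.coe_add, Pi.add_apply, add_mul]
  rw [integral_add (integrable_coe_mul_gaborAtom f p) (integrable_coe_mul_gaborAtom g p), mul_add]

theorem stftFun_smul {d : ℕ} (c : ℂ) (f : Rd d → ℂ) (p : Rd d × Rd d) :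
    stftFun (c • f) p = c * stftFun f p := by
  simp only [stftFun, Pi.smul_apply, smul_eq_mul, mul_assoc]
  rw [integral_const_mul]
  ring

theorem stronglyMeasurable_stftFun {d : ℕ} {f : Rd d → ℂ} (hf : Continuous f) :
    StronglyMeasurable (stftFun f) := by
  have h : Continuous fun q : (Rd d × Rd d) × Rd d => f q.2 * gaborAtom q.1 q.2 :=
    (hf.comp continuous_snd).mul continuous_gaborAtom_uncurry
  exact (h.stronglyMeasurable.integral_prod_right' (ν := (volume : Measure (Rd d)))).const_mul _

instance isAddHaarMeasure_phaseSpace (d : ℕ) :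
    (volume : Measure (Rd d × Rd d)).IsAddHaarMeasure :=
  Measure.prod.instIsAddHaarMeasure _ _

theorem integrable_exp_neg_mul_norm_rpow_phaseSpace (d : ℕ) {θ ε : ℝ} (hθ : 0 < θ) (hε : 0 < ε) :
    Integrable fun p : Rd d × Rd d => Real.exp (-ε * ‖p‖ ^ (1 / θ)) :=
  integrable_exp_neg_mul_norm_rpow volume hθ hε

/-- The integrand in the weak definition of the localization operator with symbol `a`. -/
noncomputable def locIntegrand {d : ℕ} {θ : ℝ} (hθ : 1 / 2 ≤ θ) (a : Rd d × Rd d → ℂ)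
    (u : GSDual θ d) (f : Rd d → ℂ) (p : Rd d × Rd d) : ℂ :=
  a p * stftDual hθ u p * conj (stftFun (fun y => conj (f y)) p)

section
variable {d : ℕ} {θ : ℝ} {a : Rd d × Rd d → ℂ}

theorem exists_norm_symbol_le (hθ : 0 < θ)
    (hbound : ∀ ε > 0, ∃ C : ℝ, ∀ᵐ p : Rd d × Rd d,
      ‖a p‖ ≤ C * Real.exp (ε * (‖p.1‖ ^ (1 / θ) + ‖p.2‖ ^ (1 / θ)))) {δ : ℝ} (hδ : 0 < δ) :
    ∃ C : ℝ, 0 ≤ C ∧ ∀ᵐ p : Rd d × Rd d, ‖a p‖ ≤ C * Real.exp (2 * δ * ‖p‖ ^ (1 / θ)) := by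
  obtain ⟨C, hC⟩ := hbound δ hδ
  refine ⟨|C|, abs_nonneg _, hC.mono fun p hp => hp.trans ?_⟩
  have hp : (0 : ℝ) ≤ 1 / θ := by positivity
  have h1 := Real.rpow_le_rpow (norm_nonneg _) (norm_fst_le p) hp
  have h2 := Real.rpow_le_rpow (norm_nonneg _) (norm_snd_le p) hp
  refine mul_le_mul (le_abs_self C) (Real.exp_le_exp.mpr ?_) (Real.exp_pos _).le (abs_nonneg _)
  nlinarith

/-- The decay rate of `V_ψ f` is fixed by `h` first; the growth of `a` and of `V_ψ u` is then chosen
small relative to it. Linearity in `M` yields continuity of `A u` as well as integrability. -/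
theorem exists_norm_locIntegrand_le (hθ : 1 / 2 ≤ θ)
    (hbound : ∀ ε > 0, ∃ C : ℝ, ∀ᵐ p : Rd d × Rd d,
      ‖a p‖ ≤ C * Real.exp (ε * (‖p.1‖ ^ (1 / θ) + ‖p.2‖ ^ (1 / θ))))
    (u : GSDual θ d) {h : ℝ} (hh : 0 < h) :
    ∃ ε > 0, ∃ C : ℝ, 0 ≤ C ∧ ∀ (f : Rd d → ℂ) (M : ℝ), ContDiff ℝ ∞ f → GSBound θ h M f →
      ∀ᵐ p, ‖locIntegrand hθ a u f p‖ ≤ C * M * Real.exp (-ε * ‖p‖ ^ (1 / θ)) := by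
  obtain ⟨ε, hε, K, hK, hV⟩ := exists_norm_stftFun_le d hθ hh
  -- The symbol contributes rate `2ε/6` and `V_ψ u` rate `ε/6`, which leaves decay at rate `ε/2`.
  have hδ : 0 < ε / 6 := by positivity
  obtain ⟨C₁, hC₁, h₁⟩ := exists_norm_symbol_le (by linarith) hbound hδ
  obtain ⟨C₂, hC₂, h₂⟩ := exists_norm_stftDual_le hθ u hδ
  refine ⟨ε / 2, by positivity, C₁ * C₂ * K, by positivity, fun f M hf hb => ?_⟩
  have hM := hb.nonneg
  filter_upwards [h₁] with p hp
  have h3 := hV f M hf hb (p.1, -p.2)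
  have h4 : ‖((p.1, -p.2) : Rd d × Rd d)‖ = ‖p‖ := by simp [Prod.norm_def]
  rw [h4] at h3
  rw [locIntegrand, conj_stftFun_conj, norm_mul, norm_mul]
  calc _ ≤ (C₁ * Real.exp (2 * (ε / 6) * ‖p‖ ^ (1 / θ))) *
        (C₂ * Real.exp (ε / 6 * ‖p‖ ^ (1 / θ))) * (K * M * Real.exp (-ε * ‖p‖ ^ (1 / θ))) := by
        gcongr
        exact h₂ p
    _ = C₁ * C₂ * K * M * (Real.exp (2 * (ε / 6) * ‖p‖ ^ (1 / θ)) *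
        Real.exp (ε / 6 * ‖p‖ ^ (1 / θ)) * Real.exp (-ε * ‖p‖ ^ (1 / θ))) := by ring
    _ = _ := by
        rw [← Real.exp_add, ← Real.exp_add]
        congr 2
        ring

theorem integrable_locIntegrand (hθ : 1 / 2 ≤ θ) (ha : AEStronglyMeasurable a volume)
    (hbound : ∀ ε > 0, ∃ C : ℝ, ∀ᵐ p : Rd d × Rd d,
      ‖a p‖ ≤ C * Real.exp (ε * (‖p.1‖ ^ (1 / θ) + ‖p.2‖ ^ (1 / θ))))
    (u : GSDual θ d) (f : GS θ d) : Integrable (locIntegrand hθ a u (f : Rd d → ℂ)) := by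
  obtain ⟨hf, h, hh, M, hb⟩ := f.2
  obtain ⟨ε, hε, C, hC, hle⟩ := exists_norm_locIntegrand_le hθ hbound u hh
  refine ((integrable_exp_neg_mul_norm_rpow_phaseSpace d (show 0 < θ by linarith) hε).const_mul
    (C * M)).mono' ?_ (hle _ M hf hb)
  refine (ha.mul (continuous_stftDual hθ u).aestronglyMeasurable).mul ?_
  have : Continuous fun y => conj ((f : Rd d → ℂ) y) := Complex.continuous_conj.comp hf.continuous
  exact (Complex.continuous_conj.comp_stronglyMeasurable
    (stronglyMeasurable_stftFun this)).aestronglyMeasurable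

/-- The localization operator with symbol `a` on tempered ultradistributions. -/
noncomputable def locOp (hθ : 1 / 2 ≤ θ) (ha : AEStronglyMeasurable a volume)
    (hbound : ∀ ε > 0, ∃ C : ℝ, ∀ᵐ p : Rd d × Rd d,
      ‖a p‖ ≤ C * Real.exp (ε * (‖p.1‖ ^ (1 / θ) + ‖p.2‖ ^ (1 / θ)))) :
    GSDual θ d →ₗ[ℂ] GSDual θ d where
  toFun u :=
    ⟨{ toFun := fun f => ∫ p, locIntegrand hθ a u (f : Rd d → ℂ) p
       map_add' := fun f g => by
        rw [← integral_add (integrable_locIntegrand hθ ha hbound u f)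
          (integrable_locIntegrand hθ ha hbound u g)]
        refine integral_congr_ae (Filter.Eventually.of_forall fun p => ?_)
        simp only [locIntegrand, conj_stftFun_conj, stftFun_add]
        ring
       map_smul' := fun c f => by
        rw [RingHom.id_apply, smul_eq_mul, ← integral_const_mul]
        refine integral_congr_ae (Filter.Eventually.of_forall fun p => ?_)
        simp only [locIntegrand, conj_stftFun_conj, Submodule.coe_smul, stftFun_smul]
        ring }, fun h hh => by
      obtain ⟨ε, hε, C, hC, hle⟩ := exists_norm_locIntegrand_le hθ hbound u hh
      refine ⟨C * ∫ p : Rd d × Rd d, Real.exp (-ε * ‖p‖ ^ (1 / θ)), fun f M hb => ?_⟩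
      have hint := integrable_exp_neg_mul_norm_rpow_phaseSpace d (show 0 < θ by linarith) hε
      refine (norm_integral_le_of_norm_le (hint.const_mul (C * M)) (hle f M f.2.1 hb)).trans_eq ?_
      rw [integral_const_mul]
      ring⟩
  map_add' u v := by
    refine Subtype.ext (LinearMap.ext fun f => ?_)
    change ∫ p, locIntegrand hθ a (u + v) (f : Rd d → ℂ) p =
      (∫ p, locIntegrand hθ a u (f : Rd d → ℂ) p) + ∫ p, locIntegrand hθ a v (f : Rd d → ℂ) p
    rw [← integral_add (integrable_locIntegrand hθ ha hbound u f)
      (integrable_locIntegrand hθ ha hbound v f)]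
    refine integral_congr_ae (Filter.Eventually.of_forall fun p => ?_)
    simp only [locIntegrand, stftDual, Submodule.coe_add, LinearMap.add_apply]
    ring
  map_smul' c u := by
    refine Subtype.ext (LinearMap.ext fun f => ?_)
    change ∫ p, locIntegrand hθ a (c • u) (f : Rd d → ℂ) p =
      c * ∫ p, locIntegrand hθ a u (f : Rd d → ℂ) p
    rw [← integral_const_mul]
    refine integral_congr_ae (Filter.Eventually.of_forall fun p => ?_)
    simp only [locIntegrand, stftDual, Submodule.coe_smul, LinearMap.smul_apply, smul_eq_mul]
    ring

theorem existsUnique_isLocalizationOperator (hθ : 1 / 2 ≤ θ) (ha : AEStronglyMeasurable a volume)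
    (hbound : ∀ ε > 0, ∃ C : ℝ, ∀ᵐ p : Rd d × Rd d,
      ‖a p‖ ≤ C * Real.exp (ε * (‖p.1‖ ^ (1 / θ) + ‖p.2‖ ^ (1 / θ)))) :
    ∃! A : GSDual θ d →ₗ[ℂ] GSDual θ d, IsLocalizationOperator hθ a A := by
  refine ⟨locOp hθ ha hbound,
    fun u f => ⟨integrable_locIntegrand hθ ha hbound u f, rfl⟩, fun A hA => ?_⟩
  refine LinearMap.ext fun u => Subtype.ext (LinearMap.ext fun f => ?_)
  exact (hA u f).2

end

/-! ### Microlocality -/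

/-! ### Phase space as `ℂ^d`: the map `chi`, norms and weight. -/

theorem norm_chi_sq {d : ℕ} (p : Rd d × Rd d) : ‖chi p‖ ^ 2 = ‖p.1‖ ^ 2 + ‖p.2‖ ^ 2 := by
  rw [EuclideanSpace.norm_sq_eq, EuclideanSpace.real_norm_sq_eq, EuclideanSpace.real_norm_sq_eq,
    ← Finset.sum_add_distrib]
  refine Finset.sum_congr rfl fun j _ => ?_
  rw [chi_apply, Complex.sq_norm, Complex.normSq_apply]
  simp
  ring

theorem chi_sub {d : ℕ} (p q : Rd d × Rd d) : chi (p - q) = chi p - chi q := by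
  ext j
  simp only [chi_apply, PiLp.sub_apply, Prod.fst_sub, Prod.snd_sub, Complex.ofReal_sub]
  ring

theorem chi_surjective {d : ℕ} : Function.Surjective (chi : Rd d × Rd d → Cd d) := by
  intro z
  refine ⟨(WithLp.toLp 2 fun j => -(z j).im, WithLp.toLp 2 fun j => -(z j).re), ?_⟩
  ext j
  rw [chi_apply]
  apply Complex.ext <;> simp

/-- The norm of the pair `p` is the maximum of its two components, whereas `‖chi p‖` is the
Euclidean norm on phase space. -/
theorem norm_le_norm_chi {d : ℕ} (p : Rd d × Rd d) : ‖p‖ ≤ ‖chi p‖ := by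
  have h := norm_chi_sq p
  refine max_le ?_ ?_
  · exact abs_le_of_sq_le_sq' (by nlinarith [sq_nonneg ‖p.2‖]) (norm_nonneg _) |>.2
  · exact abs_le_of_sq_le_sq' (by nlinarith [sq_nonneg ‖p.1‖]) (norm_nonneg _) |>.2

theorem fbiWeight_chi {d : ℕ} (p : Rd d × Rd d) : fbiWeight (chi p) = ‖p.1‖ ^ 2 / 2 := by
  rw [fbiWeight, EuclideanSpace.real_norm_sq_eq]
  congr 1
  refine Finset.sum_congr rfl fun j _ => ?_
  rw [chi_apply]
  simp

theorem integrable_exp_neg_norm_chi_sq (d : ℕ) {b : ℝ} (hb : 0 < b) :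
    Integrable fun p : Rd d × Rd d => Real.exp (-b * ‖chi p‖ ^ 2) := by
  have h := (integrable_gaussian d hb).mul_prod (integrable_gaussian d hb)
  refine h.congr (Filter.Eventually.of_forall fun p => ?_)
  simp only [norm_chi_sq, ← Real.exp_add]
  congr 1
  ring

/-- With the origin moved to the midpoint of the two centres, the parallelogram law decouples `v`
from `p.1 - q.1`, leaving a centred Gaussian times a character in `v`. -/
theorem gaborAtom_mul_gaborAtom {d : ℕ} (p q : Rd d × Rd d) (v : Rd d) :
    gaborAtom q (v + (1 / 2 : ℝ) • (p.1 + q.1)) *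
        gaborAtom (p.1, -p.2) (v + (1 / 2 : ℝ) • (p.1 + q.1)) =
      (((Real.pi ^ (-(d : ℝ) / 4)) ^ 2 * Real.exp (-‖p.1 - q.1‖ ^ 2 / 4) : ℝ) : ℂ) *
        Complex.exp (-(Complex.I * (inner ℝ (q.2 - p.2) ((1 / 2 : ℝ) • (p.1 + q.1)) : ℝ))) *
        Complex.exp (-1 * ‖v‖ ^ 2 + -Complex.I * (inner ℝ (q.2 - p.2) v : ℝ)) := by
  have h1 : ‖v + (1 / 2 : ℝ) • (p.1 + q.1) - q.1‖ ^ 2 +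
      ‖v + (1 / 2 : ℝ) • (p.1 + q.1) - p.1‖ ^ 2 = 2 * ‖v‖ ^ 2 + ‖p.1 - q.1‖ ^ 2 / 2 := by
    have e1 : v + (1 / 2 : ℝ) • (p.1 + q.1) - q.1 = v + (1 / 2 : ℝ) • (p.1 - q.1) := by
      module
    have e2 : v + (1 / 2 : ℝ) • (p.1 + q.1) - p.1 = v - (1 / 2 : ℝ) • (p.1 - q.1) := by
      module
    rw [e1, e2, norm_add_sq_real, norm_sub_sq_real, norm_smul]
    norm_num
    ring
  have h2 : (‖v + (1 / 2 : ℝ) • (p.1 + q.1) - q.1‖ : ℂ) ^ 2 =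
      2 * (‖v‖ : ℂ) ^ 2 + (‖p.1 - q.1‖ : ℂ) ^ 2 / 2 -
        (‖v + (1 / 2 : ℝ) • (p.1 + q.1) - p.1‖ : ℂ) ^ 2 := by
    rw [eq_sub_iff_add_eq]
    exact_mod_cast h1
  set m : Rd d := (1 / 2 : ℝ) • (p.1 + q.1)
  simp only [gaborAtom, gaussWindow, inner_add_right, inner_neg_left, inner_sub_left]
  push_cast
  rw [h2]
  have h3 : ∀ c A B C D E F G : ℂ, A + B + C + D = E + F + G →
      c * Complex.exp A * Complex.exp B * (c * Complex.exp C * Complex.exp D) =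
        c ^ 2 * Complex.exp E * Complex.exp F * Complex.exp G := by
    intro c A B C D E F G h
    calc _ = c ^ 2 * Complex.exp (A + B + C + D) := by
          rw [Complex.exp_add, Complex.exp_add, Complex.exp_add]; ring
      _ = _ := by
          rw [h, Complex.exp_add, Complex.exp_add]; ring
  refine h3 _ _ _ _ _ _ _ _ ?_
  ring

/-- The Fourier transform of `e^{-|v|²}` gives the same Gaussian in the frequency difference as the
midpoint identity gives in the position difference, so the overlap is isotropic in `chi (p - q)`. -/
theorem exists_norm_stftFun_gaborAtom_le (d : ℕ) :
    ∃ C : ℝ, 0 ≤ C ∧ ∀ p q : Rd d × Rd d,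
      ‖conj (stftFun (fun y => conj (gaborAtom q y)) p)‖ ≤
        C * Real.exp (-(1 / 4) * ‖chi (p - q)‖ ^ 2) := by
  refine ⟨(2 * Real.pi) ^ (-(d : ℝ) / 2) * ((Real.pi ^ (-(d : ℝ) / 4)) ^ 2 *
    ‖((Real.pi : ℂ) / 1) ^ ((Module.finrank ℝ (Rd d) : ℂ) / 2)‖), by positivity, fun p q => ?_⟩
  rw [conj_stftFun_conj, stftFun, norm_mul, Complex.norm_real, Real.norm_of_nonneg (by positivity),
    ← integral_add_right_eq_self _ ((1 / 2 : ℝ) • (p.1 + q.1))]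
  simp only [gaborAtom_mul_gaborAtom]
  rw [integral_const_mul, GaussianFourier.integral_cexp_neg_mul_sq_norm_add (by simp), norm_mul,
    norm_mul, norm_mul, Complex.norm_real, Real.norm_of_nonneg (by positivity), mul_assoc]
  have h1 : ‖Complex.exp (-(Complex.I *
      (inner ℝ (q.2 - p.2) ((1 / 2 : ℝ) • (p.1 + q.1)) : ℝ)))‖ = 1 := by
    rw [Complex.norm_exp]
    simp
  have h2 : ‖Complex.exp ((-Complex.I) ^ 2 * (‖q.2 - p.2‖ : ℂ) ^ 2 / (4 * 1))‖ =
      Real.exp (-‖p.2 - q.2‖ ^ 2 / 4) := by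
    rw [neg_sq, Complex.I_sq, Complex.norm_exp, norm_sub_rev]
    norm_cast
    norm_num
  have h3 : Real.exp (-(1 / 4) * ‖chi (p - q)‖ ^ 2) =
      Real.exp (-‖p.1 - q.1‖ ^ 2 / 4) * Real.exp (-‖p.2 - q.2‖ ^ 2 / 4) := by
    rw [norm_chi_sq, ← Real.exp_add]
    congr 1
    simp only [Prod.fst_sub, Prod.snd_sub]
    ring
  rw [h1, h2, h3, one_mul]
  refine le_of_eq ?_
  ring

/-- `Γ'` is the cone over the ball of half the radius of a ball around `z₀` inside `Γ`. Scale `z`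
into the half ball: the scaled `w` stays outside the full ball, so they are `r` apart, and the
scaled `z` has norm at most `‖z₀‖ + r`. Scaling back gives `c = r/(‖z₀‖ + r)`. -/
theorem exists_conic_subneighbourhood {d : ℕ} {Γ : Set (Cd d)} (hΓ : IsOpen Γ) (hc : IsConic Γ)
    {z₀ : Cd d} (hz₀ : z₀ ∈ Γ) :
    ∃ Γ' : Set (Cd d), IsOpen Γ' ∧ IsConic Γ' ∧ z₀ ∈ Γ' ∧
      ∃ c > 0, ∀ z ∈ Γ', ∀ w ∉ Γ, c * ‖z‖ ≤ ‖w - z‖ := by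
  obtain ⟨ρ, hρ, hball⟩ := Metric.isOpen_iff.mp hΓ z₀ hz₀
  set r : ℝ := ρ / 2 with hr
  have hr0 : 0 < r := by positivity
  refine ⟨⋃ s : {s : ℝ // 0 < s}, {z | ‖(s.1 : ℂ) • z - z₀‖ < r}, ?_, ?_, ?_,
    r / (‖z₀‖ + r), by positivity, ?_⟩
  · refine isOpen_iUnion fun s => isOpen_lt ?_ continuous_const
    exact ((continuous_id.const_smul (s.1 : ℂ)).sub continuous_const).norm
  · intro t ht z hz
    obtain ⟨s, hs⟩ := Set.mem_iUnion.mp hz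
    refine Set.mem_iUnion.mpr ⟨⟨s.1 / t, div_pos s.2 ht⟩, ?_⟩
    have : ((s.1 / t : ℝ) : ℂ) • (t : ℂ) • z = (s.1 : ℂ) • z := by
      rw [smul_smul]
      congr 1
      rw [← Complex.ofReal_mul, div_mul_cancel₀ _ ht.ne']
    simpa only [Set.mem_ofPred_eq, this] using hs
  · exact Set.mem_iUnion.mpr ⟨⟨1, one_pos⟩, by simpa using hr0⟩
  · intro z hz w hw
    obtain ⟨⟨s, hs0⟩, hs⟩ := Set.mem_iUnion.mp hz
    simp only [Set.mem_ofPred_eq] at hs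
    have hsw : ρ ≤ ‖(s : ℂ) • w - z₀‖ := by
      by_contra hlt
      push Not at hlt
      have h1 : (s : ℂ) • w ∈ Γ := hball (by rwa [Metric.mem_ball, dist_eq_norm])
      have h2 := hc s⁻¹ (inv_pos.mpr hs0) _ h1
      rw [smul_smul, ← Complex.ofReal_mul, inv_mul_cancel₀ hs0.ne', Complex.ofReal_one,
        one_smul] at h2
      exact hw h2
    have hn : ∀ v : Cd d, ‖(s : ℂ) • v‖ = s * ‖v‖ := fun v => by
      rw [norm_smul, Complex.norm_real, Real.norm_of_nonneg hs0.le]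
    have h3 : r ≤ s * ‖w - z‖ := by
      rw [← hn, smul_sub]
      have := norm_sub_norm_le ((s : ℂ) • w - z₀) ((s : ℂ) • z - z₀)
      rw [sub_sub_sub_cancel_right] at this
      linarith
    have h4 : s * ‖z‖ ≤ ‖z₀‖ + r := by
      rw [← hn]
      have := norm_add_le ((s : ℂ) • z - z₀) z₀
      rw [sub_add_cancel] at this
      linarith
    rw [div_mul_eq_mul_div, div_le_iff₀ (by positivity)]
    refine le_of_mul_le_mul_left ?_ hs0
    have hz0 := norm_nonneg z
    calc s * (r * ‖z‖) = r * (s * ‖z‖) := by ring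
      _ ≤ (s * ‖w - z‖) * (‖z₀‖ + r) := by
          gcongr
      _ = _ := by ring

/-- The Gaussian prefactor `e^{-|x|²/2}` of the atom is exactly `e^{-Φ}` at `chi p`. As `κ` does not
depend on `u`, the identity serves both `u` and `A u`. -/
theorem exists_norm_stftDual_eq_fbi (d : ℕ) :
    ∃ κ > 0, ∀ {θ : ℝ} (hθ : 1 / 2 ≤ θ) (u : GSDual θ d) (p : Rd d × Rd d),
      ‖stftDual hθ u p‖ = κ * Real.exp (-fbiWeight (chi p)) * ‖fbi hθ u (chi p)‖ := by
  have hπ := Real.pi_pos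
  set k₃ : ℝ := (2 : ℝ) ^ (-(d : ℝ) / 2) * Real.pi ^ (-(3 * d : ℝ) / 4) with hk₃
  have hk₃0 : 0 < k₃ := by positivity
  refine ⟨(2 * Real.pi) ^ (-(d : ℝ) / 2) * Real.pi ^ (-(d : ℝ) / 4) / k₃, by positivity,
    fun hθ u p => ?_⟩
  rw [stftDual_eq, fbi, fbiWeight_chi, norm_mul, norm_mul, norm_mul, Complex.norm_real,
    Complex.norm_real, Complex.norm_real, ← hk₃, Real.norm_of_nonneg (by positivity),
    Real.norm_of_nonneg (by positivity), Real.norm_of_nonneg hk₃0.le, neg_div]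
  field_simp

/-- Here `m`, `n`, `s` stand for `|p|`, `|q|`, `|p-q|`. Decay at `p` passes to `q` at a cost of at
most `(ε/2)(1 + s²)`, which `ε ≤ 1/4` keeps below half of the Gaussian exponent. -/
theorem near_exponent_le {θ ε m n s : ℝ} (hθ : 1 / 2 ≤ θ) (hε : 0 < ε) (hε' : ε ≤ 1 / 4)
    (hm : 0 ≤ m) (hn : 0 ≤ n) (hs : 0 ≤ s) (hnm : n ≤ m + s) :
    -(ε / 2) * m ^ (1 / θ) - 1 / 4 * s ^ 2 ≤ 1 - ε / 8 * n ^ (1 / θ) - 1 / 8 * s ^ 2 := by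
  have hi : 0 ≤ 1 / θ := (one_div_pos.mpr (by linarith)).le
  have h1 : n ^ (1 / θ) ≤ 4 * (m ^ (1 / θ) + s ^ (1 / θ)) :=
    (Real.rpow_le_rpow hn hnm hi).trans (add_rpow_le_four_mul hθ hm hs)
  have h2 := rpow_le_one_add_sq hθ hs
  have h3 : ε / 2 * n ^ (1 / θ) ≤ ε / 2 * (4 * (m ^ (1 / θ) + (1 + s ^ 2))) := by
    gcongr
    linarith
  have h4 : ε * (1 + s ^ 2) ≤ 1 / 4 * (1 + s ^ 2) := by gcongr
  nlinarith [sq_nonneg s]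

/-- The growth at `p` costs at most `c²/32 · n^{1/θ}` and `(1 + s²)/16`. Of the remaining `3/16 ·
s²`, two thirds are kept for integrability, and `s²/16 ≥ c²n²/16` provides the decay in `n`. -/
theorem far_exponent_le {θ δ c m n s : ℝ} (hθ : 1 / 2 ≤ θ) (hδ : 0 < δ) (hδ' : 12 * δ ≤ 1 / 16)
    (hδc : 12 * δ ≤ c ^ 2 / 32) (hc : 0 ≤ c) (hm : 0 ≤ m) (hn : 0 ≤ n) (hs : 0 ≤ s)
    (hmn : m ≤ n + s) (hcn : c * n ≤ s) :
    3 * δ * m ^ (1 / θ) - 1 / 4 * s ^ 2 ≤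
      1 + c ^ 2 / 16 - c ^ 2 / 32 * n ^ (1 / θ) - 1 / 8 * s ^ 2 := by
  have hi : 0 ≤ 1 / θ := (one_div_pos.mpr (by linarith)).le
  have h1 : m ^ (1 / θ) ≤ 4 * (n ^ (1 / θ) + s ^ (1 / θ)) :=
    (Real.rpow_le_rpow hm hmn hi).trans (add_rpow_le_four_mul hθ hn hs)
  have h2 := rpow_le_one_add_sq hθ hs
  have h2' := rpow_le_one_add_sq hθ hn
  have hnθ : 0 ≤ n ^ (1 / θ) := Real.rpow_nonneg hn _
  have h3 : 3 * δ * m ^ (1 / θ) ≤ 3 * δ * (4 * (n ^ (1 / θ) + (1 + s ^ 2))) := by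
    gcongr
    linarith
  have h4 : 12 * δ * (1 + s ^ 2) ≤ 1 / 16 * (1 + s ^ 2) := by gcongr
  have h5 : 12 * δ * n ^ (1 / θ) ≤ c ^ 2 / 32 * n ^ (1 / θ) := by gcongr
  have h6 : c ^ 2 * n ^ 2 ≤ s ^ 2 := by
    rw [← mul_pow]
    gcongr
  have h7 : c ^ 2 * n ^ (1 / θ) ≤ c ^ 2 * (1 + n ^ 2) := by gcongr
  nlinarith [sq_nonneg s]

theorem WFgl_subset_of_isLocalizationOperator {d : ℕ} {θ : ℝ} (hθ : 1 / 2 ≤ θ)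
    {a : Rd d × Rd d → ℂ}
    (hbound : ∀ ε > 0, ∃ C : ℝ, ∀ᵐ p : Rd d × Rd d,
      ‖a p‖ ≤ C * Real.exp (ε * (‖p.1‖ ^ (1 / θ) + ‖p.2‖ ^ (1 / θ))))
    {A : GSDual θ d →ₗ[ℂ] GSDual θ d} (hA : IsLocalizationOperator hθ a A) (u : GSDual θ d) :
    WFgl hθ (A u) ⊆ WFgl hθ u := by
  rintro p₀ ⟨hne, hno⟩
  refine ⟨hne, ?_⟩
  rintro ⟨Γ, hΓo, hΓc, hpΓ, ε₀, hε₀, C₀, hC₀⟩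
  refine hno ?_
  obtain ⟨Γ', hΓ'o, hΓ'c, hpΓ', c, hc, hsep⟩ := exists_conic_subneighbourhood hΓo hΓc hpΓ
  have hθ0 : 0 < θ := by linarith
  have hi : 0 ≤ 1 / θ := by positivity
  set ε : ℝ := min ε₀ (1 / 4) with hε
  have hε0 : 0 < ε := by positivity
  -- The first bound lets the growth `2δ` of the symbol consume at most half of the decay `ε`; the
  -- other two are the smallness conditions on `12δ` in `far_exponent_le`.
  set δ : ℝ := min (ε / 4) (min (1 / 192) (c ^ 2 / 384)) with hδ
  have hδ0 : 0 < δ := by positivity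
  have hδ1 : δ ≤ ε / 4 := min_le_left _ _
  have hδ2 : δ ≤ 1 / 192 := (min_le_right _ _).trans (min_le_left _ _)
  have hδ3 : δ ≤ c ^ 2 / 384 := (min_le_right _ _).trans (min_le_right _ _)
  obtain ⟨C₁, hC₁, h₁⟩ := exists_norm_symbol_le hθ0 hbound hδ0
  obtain ⟨C₂, hC₂, h₂⟩ := exists_norm_stftDual_le hθ u hδ0
  obtain ⟨C₃, hC₃, h₃⟩ := exists_norm_stftFun_gaborAtom_le d
  obtain ⟨κ, hκ, hfbi⟩ := exists_norm_stftDual_eq_fbi d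
  set ε' : ℝ := min (ε / 8) (c ^ 2 / 32) with hε'
  have hε'0 : 0 < ε' := by positivity
  set C₄ : ℝ := max (κ * |C₀|) C₂ with hC₄
  have hC₄0 : 0 ≤ C₄ := hC₂.trans (le_max_right _ _)
  set D : ℝ := C₁ * C₄ * C₃ * Real.exp (1 + c ^ 2 / 16) with hD
  have hD0 : 0 ≤ D := by positivity
  have hcone : ∀ p, chi p ∈ Γ →
      ‖stftDual hθ u p‖ ≤ C₄ * Real.exp (-ε * ‖chi p‖ ^ (1 / θ)) := by
    intro p hp
    have hp0 : 0 ≤ ‖chi p‖ ^ (1 / θ) := Real.rpow_nonneg (norm_nonneg _) _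
    rw [hfbi]
    calc _ ≤ κ * Real.exp (-fbiWeight (chi p)) *
          (|C₀| * Real.exp (-ε₀ * ‖chi p‖ ^ (1 / θ) + fbiWeight (chi p))) := by
          refine mul_le_mul_of_nonneg_left ((hC₀ _ hp).trans ?_) (by positivity)
          exact mul_le_mul_of_nonneg_right (le_abs_self _) (Real.exp_pos _).le
      _ = κ * |C₀| * Real.exp (-ε₀ * ‖chi p‖ ^ (1 / θ)) := by
          rw [Real.exp_add, Real.exp_neg (fbiWeight _)]
          field_simp
      _ ≤ _ := by
          refine mul_le_mul (le_max_left _ _) (Real.exp_le_exp.mpr ?_) (Real.exp_pos _).le hC₄0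
          have : ε ≤ ε₀ := min_le_left _ _
          nlinarith
  have hpoint : ∀ q, chi q ∈ Γ' → ∀ᵐ p : Rd d × Rd d,
      ‖a p * stftDual hθ u p * conj (stftFun (fun y => conj (gaborAtom q y)) p)‖ ≤
        D * Real.exp (-ε' * ‖chi q‖ ^ (1 / θ)) *
          Real.exp (-(1 / 8) * ‖chi (p - q)‖ ^ 2) := by
    intro q hq
    filter_upwards [h₁] with p hp
    set m : ℝ := ‖chi p‖ with hm
    set n : ℝ := ‖chi q‖ with hn
    set s : ℝ := ‖chi (p - q)‖ with hs
    have hm0 : 0 ≤ m := norm_nonneg _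
    have hn0 : 0 ≤ n := norm_nonneg _
    have hs0 : 0 ≤ s := norm_nonneg _
    have hs' : s = ‖chi p - chi q‖ := by rw [hs, chi_sub]
    have hnθ : 0 ≤ n ^ (1 / θ) := Real.rpow_nonneg hn0 _
    have hmθ : 0 ≤ m ^ (1 / θ) := Real.rpow_nonneg hm0 _
    have hpm : ‖p‖ ^ (1 / θ) ≤ m ^ (1 / θ) :=
      Real.rpow_le_rpow (norm_nonneg _) (norm_le_norm_chi p) hi
    have ha : ‖a p‖ ≤ C₁ * Real.exp (2 * δ * m ^ (1 / θ)) := hp.trans (by gcongr)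
    -- The exponent `e` is the rate of `V_ψ u` at `p`: `-ε` inside the cone, `δ` outside.
    have hcomb : ∀ e : ℝ, ‖stftDual hθ u p‖ ≤ C₄ * Real.exp (e * m ^ (1 / θ)) →
        2 * δ * m ^ (1 / θ) + e * m ^ (1 / θ) - 1 / 4 * s ^ 2 ≤
          1 + c ^ 2 / 16 - ε' * n ^ (1 / θ) - 1 / 8 * s ^ 2 →
        ‖a p * stftDual hθ u p * conj (stftFun (fun y => conj (gaborAtom q y)) p)‖ ≤
          D * Real.exp (-ε' * n ^ (1 / θ)) * Real.exp (-(1 / 8) * s ^ 2) := by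
      intro e he hexp
      rw [norm_mul, norm_mul]
      calc _ ≤ (C₁ * Real.exp (2 * δ * m ^ (1 / θ))) * (C₄ * Real.exp (e * m ^ (1 / θ))) *
            (C₃ * Real.exp (-(1 / 4) * s ^ 2)) :=
            mul_le_mul (mul_le_mul ha he (norm_nonneg _) (by positivity)) (h₃ p q)
              (norm_nonneg _) (by positivity)
        _ = C₁ * C₄ * C₃ * Real.exp (2 * δ * m ^ (1 / θ) + e * m ^ (1 / θ) - 1 / 4 * s ^ 2) := by
            rw [sub_eq_add_neg, ← neg_mul, Real.exp_add, Real.exp_add]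
            ring
        _ ≤ C₁ * C₄ * C₃ *
            Real.exp (1 + c ^ 2 / 16 - ε' * n ^ (1 / θ) - 1 / 8 * s ^ 2) := by gcongr
        _ = _ := by
            rw [hD, sub_eq_add_neg, sub_eq_add_neg, Real.exp_add, Real.exp_add, neg_mul, neg_mul]
            ring
    by_cases hpG : chi p ∈ Γ
    · refine hcomb (-ε) (hcone p hpG) ?_
      have hnm : n ≤ m + s := by
        have := norm_sub_le (chi p) (chi p - chi q)
        rwa [sub_sub_cancel, ← hs'] at this
      have h5 := near_exponent_le hθ hε0 (min_le_right _ _) hm0 hn0 hs0 hnm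
      have h6 : ε' * n ^ (1 / θ) ≤ ε / 8 * n ^ (1 / θ) := by
        gcongr
        exact min_le_left _ _
      have h7 : 2 * δ * m ^ (1 / θ) ≤ ε / 2 * m ^ (1 / θ) := by
        gcongr
        linarith
      nlinarith [sq_nonneg c]
    · refine hcomb δ ((h₂ p).trans ?_) ?_
      · refine mul_le_mul (le_max_right _ _) (Real.exp_le_exp.mpr ?_) (Real.exp_pos _).le hC₄0
        gcongr
      have hmn : m ≤ n + s := by
        have := norm_add_le (chi q) (chi p - chi q)
        rwa [add_sub_cancel, ← hs'] at this
      have h5 := far_exponent_le hθ hδ0 (by linarith) (by linarith) hc.le hm0 hn0 hs0 hmn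
        (by rw [hs']; exact hsep _ hq _ hpG)
      have h6 : ε' * n ^ (1 / θ) ≤ c ^ 2 / 32 * n ^ (1 / θ) := by
        gcongr
        exact min_le_right _ _
      linarith
  set J : ℝ := ∫ p : Rd d × Rd d, Real.exp (-(1 / 8) * ‖chi p‖ ^ 2) with hJ
  refine ⟨Γ', hΓ'o, hΓ'c, hpΓ', ε', hε'0,
    κ⁻¹ * ((2 * Real.pi) ^ (-(d : ℝ) / 2) * (D * J)), fun z hz => ?_⟩
  obtain ⟨q, rfl⟩ := chi_surjective z
  have hint := (integrable_exp_neg_norm_chi_sq d (b := 1 / 8) (by norm_num)).comp_sub_right q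
  -- The weak formula tested on a Gabor atom computes `V_ψ(Au)(q)` up to the factor `(2π)^{-d/2}`.
  have hval := (hA u ⟨gaborAtom q, gaborAtom_mem hθ q⟩).2
  have hle : ‖(A u).1 ⟨gaborAtom q, gaborAtom_mem hθ q⟩‖ ≤
      D * Real.exp (-ε' * ‖chi q‖ ^ (1 / θ)) * J := by
    rw [hval]
    refine (norm_integral_le_of_norm_le (hint.const_mul _) (hpoint q hz)).trans_eq ?_
    rw [integral_const_mul, integral_sub_right_eq_self
      (fun p : Rd d × Rd d => Real.exp (-(1 / 8) * ‖chi p‖ ^ 2)) q]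
  have hst : ‖stftDual hθ (A u) q‖ ≤ (2 * Real.pi) ^ (-(d : ℝ) / 2) *
      (D * Real.exp (-ε' * ‖chi q‖ ^ (1 / θ)) * J) := by
    rw [stftDual, norm_mul, Complex.norm_real, Real.norm_of_nonneg (by positivity)]
    gcongr
  rw [hfbi] at hst
  have hf : ‖fbi hθ (A u) (chi q)‖ = κ⁻¹ * Real.exp (fbiWeight (chi q)) *
      (κ * Real.exp (-fbiWeight (chi q)) * ‖fbi hθ (A u) (chi q)‖) := by
    rw [Real.exp_neg]
    field_simp
  rw [hf, Real.exp_add]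
  calc _ ≤ κ⁻¹ * Real.exp (fbiWeight (chi q)) * ((2 * Real.pi) ^ (-(d : ℝ) / 2) *
      (D * Real.exp (-ε' * ‖chi q‖ ^ (1 / θ)) * J)) := by gcongr
    _ = _ := by ring

end GelfandShilov

theorem mainTheorem5 (d : ℕ) (θ : ℝ) (hθ : 1 / 2 < θ)
    (a : Rd d × Rd d → ℂ) (ha : AEStronglyMeasurable a volume)
    (hbound : ∀ ε > 0, ∃ C : ℝ, ∀ᵐ p : Rd d × Rd d,
      ‖a p‖ ≤ C * Real.exp (ε * (‖p.1‖ ^ (1 / θ) + ‖p.2‖ ^ (1 / θ)))) :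
    (∃! A : GSDual θ d →ₗ[ℂ] GSDual θ d, IsLocalizationOperator hθ.le a A) ∧
      ∀ A : GSDual θ d →ₗ[ℂ] GSDual θ d, IsLocalizationOperator hθ.le a A →
        ∀ u : GSDual θ d, WFgl hθ.le (A u) ⊆ WFgl hθ.le u :=
  ⟨existsUnique_isLocalizationOperator hθ.le ha hbound,
    fun _ hA u => WFgl_subset_of_isLocalizationOperator hθ.le hbound hA u⟩
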